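/- Let $d\ge 1$ and $n\ge d+2$, and let $\xi_1,\dots,\xi_n$ be random vectors in $\mathbb R^d$ (on a common probability space) with partial sums $S_i=\xi_1+\dots+\xi_i$, $1\le i\le n$. Assume: (Br) $S_n=0$ almost surely; (Ex) $(\xi_{\sigma(1)},\dots,\xi_{\sigma(n)})\overset{d}{=}(\xi_1,\dots,\xi_n)$ for every permutation $\sigma$ of $\{1,\dots,n\}$; (GP$'$) for all $1\le i_1<\dots<i_d\le n-1$, the vectors $S_{i_1},\dots,S_{i_d}$ are linearly dependent with probability $0$. For $1\le k\le n-1$ put $$M_{n,k}^{(d)}=\frac12\sum_{1\le i_1<\dots<i_k\le n-1}\mathbf 1_{\{0\notin \mathrm{Conv}(S_{i_1},\dots,S_{i_k})\}} .$$ Let ${k+1 \brack j}$ be the (unsigned) Stirling numbers of the first kind, $t(t+1)\cdots(t+k)=\sum_{j=1}^{k+1}{k+1\brack j}t^j$, with ${k+1\brack j}=0$ for $j\le 0$ and for $j>k+1$. Then for every $k=1,\dots,n-1$, $$\mathbb E M_{n,k}^{(d)}=\frac1{(k+1)!}\binom{n-1}{k}\left({k+1\brack d}+{k+1\brack d-2}+{k+1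 \brack d-4}+\cdots\right)=\binom{n-1}{k}\,\mathbb E M_{k+1,k}^{(d)},$$ where $M_{k+1,k}^{(d)}$ is the analogous quantity for an arbitrary random bridge $T_1,\dots,T_{k+1}$ in $\mathbb R^d$ with $k+1$ increments (possibly on another probability space) that satisfies (Br) and (Ex) with $k+1$ in place of $n$ and is in general position: any $\min(d,k)$ of the vectors $T_1,\dots,T_k$ are linearly dependent with probability $0$ (for $k\ge d$ this is (GP$'$) with $k+1$ in place of $n$). Moreover, if $d=1$, then the number $N_n$ of positive terms among $S_1,\dots,S_{n-1}$ is uniformly distributed: $\mathbb P[N_n=m]=\frac1n$ for $m=0,\dots,n-1$. -/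

import Mathlib

namespace RandomBridge

open MeasureTheory ProbabilityTheory

/-- The partial sum `S_i = ξ_1 + … + ξ_i`; the increments `ξ_1, …, ξ_n` are indexed by `Fin n`,
so these are the increments with (zero-based) index `< i`. -/
def partialSum {Ω : Type*} {d n : ℕ} (ξ : Fin n → Ω → EuclideanSpace ℝ (Fin d))
    (i : ℕ) (ω : Ω) : EuclideanSpace ℝ (Fin d) :=
  ∑ j : Fin n with j.val < i, ξ j ω

/-- Bridge property: `S_n = 0` almost surely. -/
def IsBridge {Ω : Type*} [MeasurableSpace Ω] {d n : ℕ} (P : Measure Ω)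
    (ξ : Fin n → Ω → EuclideanSpace ℝ (Fin d)) : Prop :=
  ∀ᵐ ω ∂P, partialSum ξ n ω = 0

/-- Exchangeability: `(ξ_{σ(1)}, …, ξ_{σ(n)})` has the law of `(ξ_1, …, ξ_n)` for every
permutation `σ`. -/
def IsExchangeable {Ω : Type*} [MeasurableSpace Ω] {d n : ℕ} (P : Measure Ω)
    (ξ : Fin n → Ω → EuclideanSpace ℝ (Fin d)) : Prop :=
  ∀ σ : Equiv.Perm (Fin n),
    IdentDistrib (fun ω i => ξ (σ i) ω) (fun ω i => ξ i ω) P P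

/-- For all `1 ≤ i_1 < … < i_m ≤ n - 1`, the probability that `S_{i_1}, …, S_{i_m}` are linearly
dependent is zero. -/
def InGeneralPosition {Ω : Type*} [MeasurableSpace Ω] {d n : ℕ} (P : Measure Ω)
    (ξ : Fin n → Ω → EuclideanSpace ℝ (Fin d)) (m : ℕ) : Prop :=
  ∀ I ∈ (Finset.Icc 1 (n - 1)).powersetCard m,
    P {ω | ¬ LinearIndependent ℝ (fun i : I => partialSum ξ i ω)} = 0

open Classical in
/-- The random variable `M_{n,k}`: half the number of collections `1 ≤ i_1 < … < i_k ≤ n - 1`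
with `0 ∉ Conv(S_{i_1}, …, S_{i_k})`. -/
noncomputable def halfCount {Ω : Type*} {d n : ℕ} (ξ : Fin n → Ω → EuclideanSpace ℝ (Fin d))
    (k : ℕ) (ω : Ω) : ℝ :=
  (1 / 2) * ∑ I ∈ (Finset.Icc 1 (n - 1)).powersetCard k,
    if (0 : EuclideanSpace ℝ (Fin d)) ∉
      convexHull ℝ ((fun i => partialSum ξ i ω) '' (I : Set ℕ)) then 1 else 0

/-- The sum `[m, d] + [m, d-2] + [m, d-4] + …` of Stirling numbers of the first kind over the
indices `d - 2j ≥ 0`. -/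
def stirlingSum (m d : ℕ) : ℕ :=
  ∑ j ∈ Finset.range (d / 2 + 1), Nat.stirlingFirst m (d - 2 * j)

open Classical in
/-- The number of indices `1 ≤ i ≤ n - 1` such that the coordinate `c` of `S_i` is positive;
in dimension one, the number of positive terms among `S_1, …, S_{n-1}`. -/
noncomputable def positiveCount {Ω : Type*} {d n : ℕ}
    (ξ : Fin n → Ω → EuclideanSpace ℝ (Fin d)) (c : Fin d) (ω : Ω) : ℕ :=
  ((Finset.Icc 1 (n - 1)).filter fun i => 0 < partialSum ξ i ω c).card

end RandomBridge

/-! Choosing `k` indices cuts the increments into `k + 1` consecutive blocks, i.e. gives a monotone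
surjection onto `Fin (k + 1)`. Exchangeability makes the sum over all such cuts of the probability
of missing the origin invariant under a fixed reordering of the blocks (`sum_monoSurj_perm_comp`),
so this sum may be averaged over all `(k + 1)!` reorderings. For `d ≤ k` nothing random survives the
averaging: almost surely, for every cut, the number of reorderings that miss the origin is the same
constant.

To find this constant, fix generic increments and a cut. Abel summation turns a convex relation
between the partial sums into a vanishing combination of the block totals with decreasing
coefficients, and genericity allows them to be strictly decreasing
(`IsGeneric.zero_mem_convexHull_iff`). Hence the reorderings whose hull contains the origin
correspond to the chambers of the braid arrangement met by the codimension-`d` space of linear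
relations between the block totals. Such a generic subspace misses `2 * stirlingSum (k + 1) d`
chambers (`ncard_regions_offDiag_add_stirlingSum`). This follows by deletion and restriction:
forgetting a coordinate lowers the codimension by one, identifying it with one of the others
preserves the codimension, and the resulting recursion is that of the Stirling numbers.

For `k < d` the partial sums are almost surely independent, so every hull misses the origin, while
the Stirling sum is half a factorial. Uniformity in dimension one comes from cyclic shifts: the
number of positive terms after a shift is the rank of its starting height, and each rank occurs
exactly once. -/

namespace RandomBridge

open MeasureTheory ProbabilityTheory

/-! ### Regions of hyperplane arrangements: deletion and restriction. -/

section Arrangement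

variable {V κ : Type*} [AddCommGroup V] [Module ℝ V]

/-- The sign patterns of the family of functionals `f a`, `a ∈ A`, that occur at points of `C` where
none of these functionals vanishes. A pattern is recorded as the set of indices with positive
sign. -/
def regions (f : κ → V →ₗ[ℝ] ℝ) (C : Set V) (A : Finset κ) : Set (Finset κ) :=
  {s | ∃ v ∈ C, (∀ a ∈ A, f a v ≠ 0) ∧ ∀ a, a ∈ s ↔ a ∈ A ∧ 0 < f a v}

lemma regions_subset (f : κ → V →ₗ[ℝ] ℝ) (C : Set V) (A : Finset κ) :
    regions f C A ⊆ (A.powerset : Set (Finset κ)) := by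
  rintro s ⟨v, -, -, hs⟩
  simp only [Finset.coe_powerset, Set.mem_preimage, Set.mem_powerset_iff]
  exact fun a ha => ((hs a).1 ha).1

lemma regions_finite (f : κ → V →ₗ[ℝ] ℝ) (C : Set V) (A : Finset κ) :
    (regions f C A).Finite :=
  (Finset.finite_toSet _).subset (regions_subset f C A)

lemma exists_pos_forall_mul_lt {ι : Type*} (A : Finset ι) (p q : ι → ℝ)
    (hp : ∀ a ∈ A, 0 < p a) : ∃ ε > 0, ∀ a ∈ A, ε * q a < p a := by
  classical
  induction A using Finset.induction_on with
  | empty => exact ⟨1, one_pos, by simp⟩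
  | insert a A _ ih =>
    obtain ⟨ε, hε, h⟩ := ih fun b hb => hp b (Finset.mem_insert_of_mem hb)
    have hpa := hp a (Finset.mem_insert_self _ _)
    have hq : 0 < |q a| + 1 := by positivity
    refine ⟨min ε (p a / (|q a| + 1)), lt_min hε (by positivity), fun b hb => ?_⟩
    have hm : 0 < min ε (p a / (|q a| + 1)) := lt_min hε (by positivity)
    rcases Finset.mem_insert.1 hb with rfl | hb
    · calc min ε (p b / (|q b| + 1)) * q b
          ≤ min ε (p b / (|q b| + 1)) * |q b| := by gcongr; exact le_abs_self _
        _ < min ε (p b / (|q b| + 1)) * (|q b| + 1) := by gcongr; linarith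
        _ ≤ p b / (|q b| + 1) * (|q b| + 1) := by gcongr; exact min_le_right _ _
        _ = p b := by field_simp
    · have hpb := hp b (Finset.mem_insert_of_mem hb)
      rcases le_or_gt (q b) 0 with hq | hq
      · exact lt_of_le_of_lt (mul_nonpos_of_nonneg_of_nonpos hm.le hq) hpb
      · exact lt_of_le_of_lt (mul_le_mul_of_nonneg_right (min_le_left _ _) hq.le) (h b hb)

/-- A small perturbation does not change the sign pattern. -/
lemma exists_pos_forall_sign_eq (f : κ → V →ₗ[ℝ] ℝ) (A : Finset κ) (v w : V)
    (hv : ∀ a ∈ A, f a v ≠ 0) :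
    ∃ ε : ℝ, 0 < ε ∧ ∀ a ∈ A, f a (v + ε • w) ≠ 0 ∧ (0 < f a (v + ε • w) ↔ 0 < f a v) := by
  obtain ⟨ε, hε, h⟩ := exists_pos_forall_mul_lt A (fun a => |f a v|) (fun a => |f a w|)
    fun a ha => abs_pos.2 (hv a ha)
  refine ⟨ε, hε, fun a ha => ?_⟩
  have h1 := h a ha
  have h2 : |ε * f a w| < |f a v| := by rwa [abs_mul, abs_of_pos hε]
  have h3 := abs_lt.1 h2
  simp only [map_add, map_smul, smul_eq_mul]
  rcases lt_or_gt_of_ne (hv a ha) with h4 | h4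
  · rw [abs_of_neg h4] at h3
    exact ⟨by linarith, by constructor <;> intro <;> linarith⟩
  · rw [abs_of_pos h4] at h3
    exact ⟨by linarith, by constructor <;> intro <;> linarith⟩

variable [DecidableEq κ]

/-- The new functional has a sign at every point that counts, so the patterns split by that sign. -/
lemma regions_insert (f : κ → V →ₗ[ℝ] ℝ) (C : Set V) {A : Finset κ} {h : κ} (hA : h ∉ A) :
    regions f C (insert h A) =
      insert h '' regions f (C ∩ {v | 0 < f h v}) A ∪ regions f (C ∩ {v | f h v < 0}) A := by
  ext s
  constructor
  · rintro ⟨v, hv, hne, hs⟩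
    rcases lt_or_gt_of_ne (hne h (Finset.mem_insert_self _ _)) with hh | hh
    · refine Or.inr ⟨v, ⟨hv, hh⟩, fun a ha => hne a (Finset.mem_insert_of_mem ha), fun a => ?_⟩
      rw [hs, Finset.mem_insert]
      constructor
      · rintro ⟨rfl | ha, h2⟩
        · exact absurd h2 (not_lt.2 hh.le)
        · exact ⟨ha, h2⟩
      · exact fun h2 => ⟨Or.inr h2.1, h2.2⟩
    · refine Or.inl ⟨s.erase h, ⟨v, ⟨hv, hh⟩, fun a ha => hne a (Finset.mem_insert_of_mem ha),
        fun a => ?_⟩, ?_⟩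
      · rw [Finset.mem_erase, hs, Finset.mem_insert]
        constructor
        · rintro ⟨h1, h2 | ha, h3⟩
          · exact absurd h2 h1
          · exact ⟨ha, h3⟩
        · rintro ⟨h1, h2⟩
          exact ⟨fun h3 => hA (h3 ▸ h1), Or.inr h1, h2⟩
      · exact Finset.insert_erase ((hs h).2 ⟨Finset.mem_insert_self _ _, hh⟩)
  · rintro (⟨s, ⟨v, ⟨hv, hh⟩, hne, hs⟩, rfl⟩ | ⟨v, ⟨hv, hh⟩, hne, hs⟩)
    · refine ⟨v, hv, ?_, fun a => ?_⟩
      · intro a ha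
        rcases Finset.mem_insert.1 ha with rfl | ha
        exacts [ne_of_gt hh, hne a ha]
      · rw [Finset.mem_insert, Finset.mem_insert, hs]
        constructor
        · rintro (rfl | h1)
          exacts [⟨Or.inl rfl, hh⟩, ⟨Or.inr h1.1, h1.2⟩]
        · rintro ⟨rfl | h1, h2⟩
          exacts [Or.inl rfl, Or.inr ⟨h1, h2⟩]
    · refine ⟨v, hv, ?_, fun a => ?_⟩
      · intro a ha
        rcases Finset.mem_insert.1 ha with rfl | ha
        exacts [ne_of_lt hh, hne a ha]
      · rw [Finset.mem_insert, hs]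
        constructor
        · exact fun h1 => ⟨Or.inr h1.1, h1.2⟩
        · rintro ⟨rfl | h1, h2⟩
          exacts [absurd h2 (not_lt.2 (le_of_lt hh)), ⟨h1, h2⟩]

/-- Deletion and restriction for the number of regions. -/
lemma ncard_regions_insert (f : κ → V →ₗ[ℝ] ℝ) (W : Submodule ℝ V) {A : Finset κ} {h : κ}
    (hA : h ∉ A) {w : V} (hw : w ∈ W) (hfw : f h w ≠ 0) :
    (regions f W (insert h A)).ncard =
      (regions f W A).ncard + (regions f (W ⊓ LinearMap.ker (f h) : Submodule ℝ V) A).ncard := by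
  obtain ⟨w, hw, hfw⟩ : ∃ w ∈ W, 0 < f h w := by
    rcases lt_or_gt_of_ne hfw with h1 | h1
    · exact ⟨-w, W.neg_mem hw, by simpa using h1⟩
    · exact ⟨w, hw, h1⟩
  set P := regions f ((W : Set V) ∩ {v | 0 < f h v}) A with hP
  set N := regions f ((W : Set V) ∩ {v | f h v < 0}) A with hN
  -- A point on the hyperplane can be pushed slightly along `w` or `-w` to either side without
  -- changing its other signs.
  have key : ∀ v ∈ W, f h v = 0 → ∀ s : Finset κ, (∀ a ∈ A, f a v ≠ 0) →
      (∀ a, a ∈ s ↔ a ∈ A ∧ 0 < f a v) → s ∈ P ∧ s ∈ N := by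
    intro v hv hv0 s hne hs
    obtain ⟨ε, hε, h1⟩ := exists_pos_forall_sign_eq f A v w hne
    obtain ⟨δ, hδ, h2⟩ := exists_pos_forall_sign_eq f A v (-w) hne
    refine ⟨⟨v + ε • w, ⟨W.add_mem hv (W.smul_mem _ hw), ?_⟩, fun a ha => (h1 a ha).1, fun a => ?_⟩,
      ⟨v + δ • -w, ⟨W.add_mem hv (W.smul_mem _ (W.neg_mem hw)), ?_⟩, fun a ha => (h2 a ha).1,
        fun a => ?_⟩⟩
    · simp only [Set.mem_ofPred_eq, map_add, map_smul, smul_eq_mul, hv0]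
      positivity
    · rw [hs]
      exact and_congr_right fun ha => (h1 a ha).2.symm
    · simp only [Set.mem_ofPred_eq, map_add, map_smul, smul_eq_mul, hv0, map_neg]
      have := mul_pos hδ hfw
      linarith
    · rw [hs]
      exact and_congr_right fun ha => (h2 a ha).2.symm
  have hU : P ∪ N = regions f W A := by
    ext s
    constructor
    · rintro (⟨v, hv, h1, h2⟩ | ⟨v, hv, h1, h2⟩)
      exacts [⟨v, hv.1, h1, h2⟩, ⟨v, hv.1, h1, h2⟩]
    · rintro ⟨v, hv, h1, h2⟩
      rcases lt_trichotomy (f h v) 0 with h3 | h3 | h3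
      · exact Or.inr ⟨v, ⟨hv, h3⟩, h1, h2⟩
      · exact Or.inl (key v hv h3 s h1 h2).1
      · exact Or.inl ⟨v, ⟨hv, h3⟩, h1, h2⟩
  -- If one pattern occurs on both sides, the segment joining two witnesses crosses the hyperplane.
  -- The positive combination below kills `f h` and keeps the common signs. The count then follows
  -- from `|P| + |N| = |P ∪ N| + |P ∩ N|`.
  have hI : P ∩ N = regions f (W ⊓ LinearMap.ker (f h) : Submodule ℝ V) A := by
    ext s
    constructor
    · rintro ⟨⟨v, ⟨hv, hv0⟩, h1, h2⟩, ⟨u, ⟨hu, hu0⟩, h3, h4⟩⟩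
      simp only [Set.mem_ofPred_eq] at hv0 hu0
      have hsign : ∀ a ∈ A, (0 < f a v ∧ 0 < f a u) ∨ (f a v < 0 ∧ f a u < 0) := by
        intro a ha
        have h5 := (h2 a).symm.trans (h4 a)
        rcases lt_or_gt_of_ne (h1 a ha) with h6 | h6
        · rcases lt_or_gt_of_ne (h3 a ha) with h7 | h7
          · exact Or.inr ⟨h6, h7⟩
          · exact absurd (h5.2 ⟨ha, h7⟩).2 (not_lt.2 h6.le)
        · exact Or.inl ⟨h6, (h5.1 ⟨ha, h6⟩).2⟩
      have hval : ∀ a, f a ((-f h u) • v + (f h v) • u) = (-f h u) * f a v + f h v * f a u := by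
        intro a; simp
      have hpos : 0 < -f h u := by linarith
      refine ⟨(-f h u) • v + (f h v) • u, ⟨W.add_mem (W.smul_mem _ hv) (W.smul_mem _ hu), ?_⟩,
        fun a ha => ?_, fun a => ?_⟩
      · simp only [SetLike.mem_coe, LinearMap.mem_ker, hval]
        ring
      · rw [hval]
        rcases hsign a ha with ⟨h5, h6⟩ | ⟨h5, h6⟩
        · have := mul_pos hpos h5
          have := mul_pos hv0 h6
          linarith
        · have := mul_neg_of_pos_of_neg hpos h5
          have := mul_neg_of_pos_of_neg hv0 h6
          linarith
      · rw [h2, hval]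
        refine and_congr_right fun ha => ?_
        rcases hsign a ha with ⟨h5, h6⟩ | ⟨h5, h6⟩
        · have := mul_pos hpos h5
          have := mul_pos hv0 h6
          constructor <;> intro <;> linarith
        · have := mul_neg_of_pos_of_neg hpos h5
          have := mul_neg_of_pos_of_neg hv0 h6
          constructor <;> intro <;> linarith
    · rintro ⟨v, ⟨hv, hv0⟩, h1, h2⟩
      exact key v hv hv0 s h1 h2
  have hfP : P.Finite := regions_finite _ _ _
  have hfN : N.Finite := regions_finite _ _ _
  have hh : ∀ s ∈ P ∪ N, h ∉ s := by
    rintro s (hs | hs) h1 <;> exact hA (Finset.mem_powerset.1 (regions_subset f _ _ hs) h1)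
  rw [regions_insert f _ hA, Set.ncard_union_eq _ (hfP.image _) hfN, Set.InjOn.ncard_image,
    ← hU, ← hI, Set.ncard_union_add_ncard_inter _ _ hfP hfN]
  · intro s hs t ht hst
    have := congrArg (fun r : Finset κ => r.erase h) hst
    simpa [Finset.erase_insert (hh s (Or.inl hs)), Finset.erase_insert (hh t (Or.inl ht))] using this
  · rw [Set.disjoint_left]
    rintro _ ⟨s, -, rfl⟩ h1
    exact hh _ (Or.inr h1) (Finset.mem_insert_self _ _)

/-- Functionals that agree up to sign with functionals already present create no new regions. -/
lemma ncard_regions_eq_of_subset (f : κ → V →ₗ[ℝ] ℝ) (C : Set V) {A B : Finset κ} (hAB : A ⊆ B)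
    (hB : ∀ b ∈ B, ∃ a ∈ A, (∀ v ∈ C, f b v = f a v) ∨ (∀ v ∈ C, f b v = -f a v)) :
    (regions f C B).ncard = (regions f C A).ncard := by
  have himg : regions f C A = (fun s => s ∩ A) '' regions f C B := by
    ext s
    constructor
    · rintro ⟨v, hv, h1, h2⟩
      refine ⟨B.filter fun b => 0 < f b v, ⟨v, hv, fun b hb => ?_, fun b => by simp⟩, ?_⟩
      · obtain ⟨a, ha, h3 | h3⟩ := hB b hb
        · rw [h3 v hv]; exact h1 a ha
        · rw [h3 v hv]; exact neg_ne_zero.2 (h1 a ha)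
      · ext a
        simp only [Finset.mem_inter, Finset.mem_filter, h2]
        exact ⟨fun h => ⟨h.2, h.1.2⟩, fun h => ⟨⟨hAB h.1, h.2⟩, h.1⟩⟩
    · rintro ⟨s, ⟨v, hv, h1, h2⟩, rfl⟩
      refine ⟨v, hv, fun a ha => h1 a (hAB ha), fun a => ?_⟩
      simp only [Finset.mem_inter, h2]
      exact ⟨fun h => ⟨h.2, h.1.2⟩, fun h => ⟨⟨hAB h.1, h.2⟩, h.1⟩⟩
  rw [himg, Set.InjOn.ncard_image]
  rintro s ⟨v, hv, h1, h2⟩ s' ⟨v', hv', h1', h2'⟩ hss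
  have hA : ∀ a ∈ A, (0 < f a v ↔ 0 < f a v') := by
    intro a ha
    have h3 := congrArg (fun r : Finset κ => a ∈ r) hss
    simp only [Finset.mem_inter, ha, and_true, eq_iff_iff, h2, h2', hAB ha, true_and] at h3
    exact h3
  ext b
  rw [h2, h2']
  refine and_congr_right fun hb => ?_
  obtain ⟨a, ha, h3 | h3⟩ := hB b hb
  · rw [h3 v hv, h3 v' hv', hA a ha]
  · rw [h3 v hv, h3 v' hv']
    have e1 := h1 a (hAB ha)
    have e2 := h1' a (hAB ha)
    have e3 := hA a ha
    have e4 : 0 < -f a v ↔ ¬ 0 < f a v := by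
      rw [neg_pos, not_lt]; exact ⟨le_of_lt, fun h => lt_of_le_of_ne h e1⟩
    have e5 : 0 < -f a v' ↔ ¬ 0 < f a v' := by
      rw [neg_pos, not_lt]; exact ⟨le_of_lt, fun h => lt_of_le_of_ne h e2⟩
    rw [e4, e5, e3]

end Arrangement

/-! ### Parity sums of Stirling numbers. -/

section Stirling

lemma stirlingSum_zero (m : ℕ) : stirlingSum (m + 1) 0 = 0 := by
  simp [stirlingSum]

lemma stirlingSum_one (m : ℕ) : stirlingSum m 1 = Nat.stirlingFirst m 1 := by
  simp [stirlingSum]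

lemma stirlingSum_add_two (m d : ℕ) :
    stirlingSum m (d + 2) = Nat.stirlingFirst m (d + 2) + stirlingSum m d := by
  have h : (d + 2) / 2 + 1 = d / 2 + 1 + 1 := by omega
  rw [stirlingSum, h, Finset.sum_range_succ', stirlingSum, add_comm]
  refine congrArg₂ _ (by simp) (Finset.sum_congr rfl fun j _ => ?_)
  congr 1
  omega

/-- The Stirling recursion, summed over every second column. All rows involved have positive index,
so column zero contributes nothing. -/
lemma stirlingSum_succ_succ (m d : ℕ) :
    stirlingSum (m + 2) (d + 1) =
      (m + 1) * stirlingSum (m + 1) (d + 1) + stirlingSum (m + 1) d := by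
  induction d using Nat.twoStepInduction with
  | zero =>
    rw [zero_add, stirlingSum_one, stirlingSum_one, stirlingSum_zero, Nat.stirlingFirst_succ_succ]
    simp
  | one =>
    rw [stirlingSum_add_two, stirlingSum_add_two, stirlingSum_zero, stirlingSum_zero,
      stirlingSum_one, Nat.stirlingFirst_succ_succ, add_zero, add_zero]
  | more d ih _ =>
    rw [stirlingSum_add_two _ (d + 1), stirlingSum_add_two _ (d + 1), stirlingSum_add_two _ d, ih,
      Nat.stirlingFirst_succ_succ]
    ring

/-- In this range the sum takes in every nonzero entry of one parity. The row polynomial vanishes at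
`-1`, so the two parity classes each carry half of the row sum; the proof gets this from the
recursion. -/
lemma two_mul_stirlingSum_eq_factorial (m d : ℕ) (h : m + 1 ≤ d) :
    2 * stirlingSum (m + 2) d = (m + 2).factorial := by
  induction m generalizing d with
  | zero =>
    induction d using Nat.twoStepInduction with
    | zero => omega
    | one => simp [stirlingSum_one, Nat.stirlingFirst]
    | more d ih _ =>
      rw [stirlingSum_add_two]
      rcases d with _ | d
      · simp [stirlingSum_zero, Nat.stirlingFirst]
      · rw [mul_add, ih (by omega), Nat.stirlingFirst_eq_zero_of_lt (by omega), mul_zero, zero_add]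
  | succ m ih =>
    obtain ⟨d, rfl⟩ : ∃ e, d = e + 1 := ⟨d - 1, by omega⟩
    rw [stirlingSum_succ_succ, mul_add, mul_left_comm, ih _ (by omega), ih _ (by omega),
      Nat.factorial_succ (m + 2)]
    ring

end Stirling

/-! ### Chambers of the braid arrangement met by a generic subspace. -/

section Braid

variable {ι : Type*}

/-- The functional `t ↦ t i - t j`. -/
def coordDiff (p : ι × ι) : (ι → ℝ) →ₗ[ℝ] ℝ := 
  LinearMap.proj (R := ℝ) (φ := fun _ : ι => ℝ) p.1 - LinearMap.proj p.2

@[simp] lemma coordDiff_apply (p : ι × ι) (t : ι → ℝ) : coordDiff p t = t p.1 - t p.2 := rfl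

lemma exists_surjOn_fin (S : Finset ι) {r : ℕ} (hr : 0 < r) (h : r ≤ S.card) :
    ∃ c : ι → Fin r, Set.SurjOn c S Set.univ := by
  have : Nonempty (Fin r) := ⟨⟨0, hr⟩⟩
  let e : Fin r → ι := fun j => (S.equivFin.symm (Fin.castLE h j) : S)
  have he : Function.Injective e := fun i j hij =>
    Fin.castLE_injective h (S.equivFin.symm.injective (Subtype.ext hij))
  exact ⟨Function.invFun e, fun j _ =>
    ⟨e j, (S.equivFin.symm (Fin.castLE h j)).2, Function.leftInverse_invFun he j⟩⟩

/-- On the coordinates in `S`, the subspace `W` meets every intersection of diagonal hyperplanes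
of dimension `d + 1` in the constants only. -/
def IsGenericOn (W : Submodule ℝ (ι → ℝ)) (S : Finset ι) (d : ℕ) : Prop :=
  ∀ c : ι → Fin (d + 1), Set.SurjOn c S Set.univ → ∀ t : Fin (d + 1) → ℝ, ∀ w ∈ W,
    (∀ i ∈ S, w i = t (c i)) → ∀ p q, t p = t q

variable [DecidableEq ι]

/-- The hyperplanes `t a = t i` are added one at a time. On such a hyperplane the functional `t a -
t j` agrees with `t i - t j`, which is already present, so each restriction is again the braid
arrangement on `S`. -/
lemma ncard_regions_offDiag_union (W : Submodule ℝ (ι → ℝ)) {S : Finset ι} {a : ι} (ha : a ∉ S)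
    (hW : ∀ i ∈ S, ∃ w ∈ W, w a ≠ w i) (T : Finset ι) (hT : T ⊆ S) :
    (regions coordDiff (W : Set (ι → ℝ)) (S.offDiag ∪ T.image fun j => (a, j))).ncard =
      (regions coordDiff (W : Set (ι → ℝ)) S.offDiag).ncard +
        ∑ i ∈ T, (regions coordDiff
          (W ⊓ LinearMap.ker (coordDiff (a, i)) : Submodule ℝ (ι → ℝ)) S.offDiag).ncard := by
  induction T using Finset.induction_on with
  | empty => simp
  | insert i T hi ih =>
    obtain ⟨w, hw, hne⟩ := hW i (hT (Finset.mem_insert_self _ _))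
    have hiS := hT (Finset.mem_insert_self _ _)
    have hTS : T ⊆ S := (Finset.subset_insert _ _).trans hT
    rw [Finset.image_insert, Finset.union_insert,
      ncard_regions_insert coordDiff W _ hw (by simpa [sub_eq_zero] using hne), ih hTS,
      Finset.sum_insert hi, add_assoc, add_comm (∑ _ ∈ T, _)]
    · congr 2
      refine ncard_regions_eq_of_subset _ _ Finset.subset_union_left fun b hb => ?_
      rcases Finset.mem_union.1 hb with hb | hb
      · exact ⟨b, hb, Or.inl fun _ _ => rfl⟩
      · obtain ⟨j, hj, rfl⟩ := Finset.mem_image.1 hb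
        refine ⟨(i, j), Finset.mem_offDiag.2 ⟨hiS, hTS hj, fun h : i = j => hi (h ▸ hj)⟩,
          Or.inl fun v hv => ?_⟩
        have : v a - v i = 0 := LinearMap.mem_ker.1 hv.2
        simp only [coordDiff_apply]
        linarith
    · simp only [Finset.mem_union, Finset.mem_offDiag, Finset.mem_image, Prod.mk.injEq, true_and,
        exists_eq_right, not_or]
      exact ⟨fun h => ha h.1, hi⟩

/-- The recursion for the number of regions of the braid arrangement in a subspace when one more
coordinate is taken into account. -/
lemma ncard_regions_offDiag_insert (W : Submodule ℝ (ι → ℝ)) {S : Finset ι} {a : ι} (ha : a ∉ S)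
    (hW : ∀ i ∈ S, ∃ w ∈ W, w a ≠ w i) :
    (regions coordDiff (W : Set (ι → ℝ)) (insert a S).offDiag).ncard =
      (regions coordDiff (W : Set (ι → ℝ)) S.offDiag).ncard +
        ∑ i ∈ S, (regions coordDiff
          (W ⊓ LinearMap.ker (coordDiff (a, i)) : Submodule ℝ (ι → ℝ)) S.offDiag).ncard := by
  rw [← ncard_regions_offDiag_union W ha hW S subset_rfl]
  refine ncard_regions_eq_of_subset _ _ ?_ fun b hb => ?_
  · intro b hb
    rcases Finset.mem_union.1 hb with hb | hb
    · exact Finset.offDiag_mono (Finset.subset_insert _ _) hb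
    · obtain ⟨j, hj, rfl⟩ := Finset.mem_image.1 hb
      simp only [Finset.mem_offDiag, Finset.mem_insert, true_or, true_and]
      exact ⟨Or.inr hj, fun h => ha (h ▸ hj)⟩
  · obtain ⟨i, j⟩ := b
    simp only [Finset.mem_offDiag, Finset.mem_insert] at hb
    obtain ⟨hi | hi, hj | hj, hij⟩ := hb
    · exact absurd (hi.trans hj.symm) hij
    · exact ⟨(a, j), by simp [hj], Or.inl fun v _ => by rw [hi]⟩
    · exact ⟨(a, i), by simp [hi], Or.inr fun v _ => by simp [hj]⟩
    · exact ⟨(i, j), by simp [hi, hj, hij], Or.inl fun v _ => rfl⟩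

/-- This is the codimension-zero case: every ordering of the coordinates in `S` occurs. -/
lemma ncard_regions_offDiag_of_full (S : Finset ι) (W : Submodule ℝ (ι → ℝ))
    (hW : ∀ t : ι → ℝ, ∃ w ∈ W, ∀ i ∈ S, w i = t i) :
    (regions coordDiff (W : Set (ι → ℝ)) S.offDiag).ncard = S.card.factorial := by
  induction S using Finset.induction_on generalizing W with
  | empty =>
    have : regions coordDiff (W : Set (ι → ℝ)) (∅ : Finset ι).offDiag = {∅} := by
      ext s
      simp only [regions, Finset.offDiag_empty, Set.mem_ofPred_eq, Set.mem_singleton_iff]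
      constructor
      · rintro ⟨v, -, -, h⟩
        exact Finset.eq_empty_of_forall_notMem fun a ha => by simpa using (h a).1 ha
      · rintro rfl
        exact ⟨0, W.zero_mem, by simp, by simp⟩
    rw [this]
    simp
  | insert a S ha ih =>
    rw [ncard_regions_offDiag_insert W ha, ih, Finset.sum_congr rfl fun i hi => ih _ ?_,
      Finset.sum_const, Finset.card_insert_of_notMem ha, Nat.factorial_succ, smul_eq_mul]
    · ring
    · intro t
      -- Prescribing the value `t i` at `a` places the lift on the restricting hyperplane.
      obtain ⟨w, hw, h⟩ := hW (Function.update t a (t i))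
      have hia : i ≠ a := fun h => ha (h ▸ hi)
      refine ⟨w, ⟨hw, ?_⟩, fun j hj => ?_⟩
      · have h1 := h a (Finset.mem_insert_self _ _)
        have h2 := h i (Finset.mem_insert_of_mem hi)
        rw [Function.update_self] at h1
        rw [Function.update_of_ne hia] at h2
        simp [h1, h2]
      · rw [h j (Finset.mem_insert_of_mem hj), Function.update_of_ne fun h : j = a => ha (h ▸ hj)]
    · intro t
      obtain ⟨w, hw, h⟩ := hW t
      exact ⟨w, hw, fun i hi => h i (Finset.mem_insert_of_mem hi)⟩
    · intro i hi
      obtain ⟨w, hw, h⟩ := hW (Pi.single a 1)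
      refine ⟨w, hw, ?_⟩
      rw [h a (Finset.mem_insert_self _ _), h i (Finset.mem_insert_of_mem hi), Pi.single_eq_same,
        Pi.single_eq_of_ne fun h : i = a => ha (h ▸ hi)]
      exact one_ne_zero

/-- A subspace in general position of codimension `d` meets all chambers of the braid arrangement
but `2 * stirlingSum S.card d`. -/
theorem ncard_regions_offDiag_add_stirlingSum (S : Finset ι) :
    ∀ (d : ℕ) (V : Type) [AddCommGroup V] [Module ℝ V] [FiniteDimensional ℝ V]
      (φ : (ι → ℝ) →ₗ[ℝ] V) (W : Submodule ℝ (ι → ℝ)), Module.finrank ℝ V = d →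
      d + 1 ≤ S.card → (∀ t, φ t = 0 → ∃ w ∈ W, ∀ i ∈ S, w i = t i) → IsGenericOn W S d →
      (regions coordDiff (W : Set (ι → ℝ)) S.offDiag).ncard + 2 * stirlingSum S.card d =
        S.card.factorial := by
  -- `W` and `ker φ` are compared only on the coordinates in `S`, so `S` can shrink while the
  -- ambient space stays fixed.
  induction S using Finset.induction_on with
  | empty => intro d V _ _ _ φ W _ h; simp at h
  | insert a S ha ih =>
    intro d V _ _ _ φ W hd hcard hφ hgen
    have hne : ∀ {j}, j ∈ S → j ≠ a := fun hj h => ha (h ▸ hj)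
    obtain ⟨m, hm⟩ : ∃ m, (insert a S).card = m + 1 := ⟨S.card, Finset.card_insert_of_notMem ha⟩
    have hS : S.card = m := by rw [Finset.card_insert_of_notMem ha] at hm; omega
    rcases d with _ | d
    · rw [hm, stirlingSum_zero, ncard_regions_offDiag_of_full, hm, mul_zero, add_zero]
      have := Module.finrank_zero_iff.1 hd
      exact fun t => hφ t (Subsingleton.elim _ _)
    obtain ⟨m, rfl⟩ : ∃ l, m = l + 1 := ⟨m - 1, by omega⟩
    -- With as many coordinates as colours, a surjective colouring is a bijection. Genericity then
    -- leaves only constant vectors, and no chamber is met.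
    rcases Nat.eq_or_lt_of_le hcard with heq | hlt
    · have : regions coordDiff (W : Set (ι → ℝ)) (insert a S).offDiag = ∅ := by
        refine Set.eq_empty_of_forall_notMem ?_
        rintro s ⟨v, hv, h1, -⟩
        obtain ⟨i, hi⟩ : S.Nonempty := Finset.card_pos.1 (by omega)
        obtain ⟨c, hc⟩ := exists_surjOn_fin (insert a S) (Nat.succ_pos (d + 1)) hcard
        have hinj : Set.InjOn c (insert a S : Finset ι) := by
          refine Finset.injOn_of_surjOn_of_card_le c (t := Finset.univ) (by simp)
            (by simpa using hc) (by simp [← heq])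
        have hconst := hgen c hc (fun q => v (hc (Set.mem_univ q)).choose) v hv fun j hj => by
          have h2 := (hc (Set.mem_univ (c j))).choose_spec
          exact congrArg v (hinj h2.1 hj h2.2).symm
        have h3 : ∀ j ∈ insert a S, v (hc (Set.mem_univ (c j))).choose = v j := fun j hj => by
          have h2 := (hc (Set.mem_univ (c j))).choose_spec
          exact congrArg v (hinj h2.1 hj h2.2)
        refine h1 (a, i) ?_ ?_
        · simp only [Finset.mem_offDiag, Finset.mem_insert, true_or, true_and]
          exact ⟨Or.inr hi, (hne hi).symm⟩
        · rw [coordDiff_apply, sub_eq_zero, ← h3 a (Finset.mem_insert_self _ _),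
            ← h3 i (Finset.mem_insert_of_mem hi)]
          exact hconst _ _
      rw [this, Set.ncard_empty, zero_add, hm]
      exact two_mul_stirlingSum_eq_factorial m (d + 1) (by omega)
    -- If `w a = w i` held on all of `W`, then among vectors with `d + 3` blocks, two of which are
    -- `{a}` and `{i}` within the coordinates considered, `φ` would vanish only on constants:
    -- merging those two blocks leaves `d + 2`, and genericity applies. But `V` has dimension `d +
    -- 1`, so rank-nullity forces a kernel of dimension at least two.
    have hW : ∀ i ∈ S, ∃ w ∈ W, w a ≠ w i := by
      intro i hi
      by_contra! hcon
      obtain ⟨c₀, hc₀⟩ := exists_surjOn_fin (S.erase i) (Nat.succ_pos d)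
        (by rw [Finset.card_erase_of_mem hi]; omega)
      let c : ι → Fin (d + 3) := fun j => if j = a then 0 else if j = i then 1 else
        (c₀ j).succ.succ
      have hca : c a = 0 := by simp [c]
      have hci : c i = 1 := by simp [c, hne hi]
      let ψ : (Fin (d + 3) → ℝ) →ₗ[ℝ] V := φ ∘ₗ LinearMap.funLeft ℝ ℝ c
      have hker : LinearMap.ker ψ ≤ Submodule.span ℝ {(fun _ => 1 : Fin (d + 3) → ℝ)} := by
        intro s hs
        obtain ⟨w, hw, hws⟩ := hφ _ hs
        simp only [LinearMap.funLeft_apply] at hws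
        have h01 : s 0 = s 1 := by
          rw [← hca, ← hci, ← hws a (Finset.mem_insert_self _ _),
            ← hws i (Finset.mem_insert_of_mem hi), hcon w hw]
        have hs' : ∀ q, s q = s (Fin.succ (Fin.predAbove 0 q)) := by
          intro q
          refine Fin.cases ?_ (fun q => ?_) q
          · simpa using h01
          · simp
        have hconst := hgen (fun j => Fin.predAbove 0 (c j)) ?_ (fun q => s q.succ) w hw
          fun j hj => by rw [hws j hj, hs']
        · rw [Submodule.mem_span_singleton]
          refine ⟨s 1, funext fun q => ?_⟩
          rw [hs' q, ← hconst 0 (Fin.predAbove 0 q)]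
          simp
        · intro q _
          refine Fin.cases ?_ (fun q => ?_) q
          · exact ⟨a, Finset.mem_insert_self _ _, by simp [hca]⟩
          · obtain ⟨j, hj, hjq⟩ := hc₀ (Set.mem_univ q)
            have hjS := Finset.mem_of_mem_erase hj
            refine ⟨j, Finset.mem_insert_of_mem hjS, ?_⟩
            simp [c, hne hjS, Finset.ne_of_mem_erase hj, hjq]
      have h1 := LinearMap.finrank_range_add_finrank_ker ψ
      have h2 := Submodule.finrank_mono hker
      have h3 := finrank_span_singleton (K := ℝ) (v := (fun _ => 1 : Fin (d + 3) → ℝ))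
        (fun h => one_ne_zero (congrFun h 0))
      have h4 := Submodule.finrank_le (LinearMap.range ψ)
      rw [Module.finrank_fin_fun] at h1
      omega
    -- Otherwise the indicator of `a` would lift to `W`, a nonconstant vector with only two values.
    have hea : φ (Pi.single a 1) ≠ 0 := by
      intro h0
      obtain ⟨w, hw, hws⟩ := hφ _ h0
      obtain ⟨c₀, hc₀⟩ := exists_surjOn_fin S (Nat.succ_pos d) (by omega)
      have := hgen (fun j => if j = a then 0 else (c₀ j).succ) ?_ (Pi.single 0 1) w hw ?_ 0 1
      · simp at this
      · intro q _
        refine Fin.cases ?_ (fun q => ?_) q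
        · exact ⟨a, Finset.mem_insert_self _ _, by simp⟩
        · obtain ⟨j, hj, hjq⟩ := hc₀ (Set.mem_univ q)
          exact ⟨j, Finset.mem_insert_of_mem hj, by simp [hne hj, hjq]⟩
      · intro i hi
        rw [hws i hi]
        by_cases h : i = a
        · simp [h]
        · simp [h]
    -- Deletion: with coordinate `a` free, only `φ` modulo `φ (Pi.single a 1)` constrains the rest,
    -- so the codimension drops to `d`.
    have hdel : (regions coordDiff (W : Set (ι → ℝ)) S.offDiag).ncard + 2 * stirlingSum S.card d =
        S.card.factorial := by
      refine ih d (V ⧸ Submodule.span ℝ {φ (Pi.single a 1)})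
        ((Submodule.mkQ _) ∘ₗ φ) W ?_ (by omega) ?_ ?_
      · have h1 := Submodule.finrank_quotient_add_finrank (Submodule.span ℝ {φ (Pi.single a 1)})
        rw [finrank_span_singleton hea] at h1
        omega
      · intro t ht
        have h1 : φ t ∈ Submodule.span ℝ {φ (Pi.single a 1)} := by simpa using ht
        obtain ⟨r, hr⟩ := Submodule.mem_span_singleton.1 h1
        obtain ⟨w, hw, hws⟩ := hφ (t - r • Pi.single a 1) (by simp [hr])
        refine ⟨w, hw, fun i hi => ?_⟩
        rw [hws i (Finset.mem_insert_of_mem hi)]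
        simp [hne hi]
      · intro c hc t w hw hwt p q
        have := hgen (fun j => if j = a then 0 else (c j).succ) ?_ (Fin.cons (w a) t) w hw ?_
          p.succ q.succ
        · simpa using this
        · intro q _
          refine Fin.cases ?_ (fun q => ?_) q
          · exact ⟨a, Finset.mem_insert_self _ _, by simp⟩
          · obtain ⟨j, hj, hjq⟩ := hc (Set.mem_univ q)
            exact ⟨j, Finset.mem_insert_of_mem hj, by simp [hne hj, hjq]⟩
        · intro i hi
          rcases Finset.mem_insert.1 hi with rfl | hi
          · simp
          · simp [hne hi, hwt i hi]
    -- Restriction: substituting `t i` for `t a` removes a coordinate and keeps the target `V`, so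
    -- the codimension stays `d + 1`.
    have hres : ∀ i ∈ S, (regions coordDiff
        (W ⊓ LinearMap.ker (coordDiff (a, i)) : Submodule ℝ (ι → ℝ)) S.offDiag).ncard +
          2 * stirlingSum S.card (d + 1) = S.card.factorial := by
      intro i hi
      have hf : ∀ j, j ≠ a → (if j = a then i else j) = j := fun j hj => by simp [hj]
      refine ih (d + 1) V (φ ∘ₗ LinearMap.funLeft ℝ ℝ fun j => if j = a then i else j) _ hd
        (by omega) ?_ ?_
      · intro t ht
        obtain ⟨w, hw, hws⟩ := hφ _ ht
        simp only [LinearMap.funLeft_apply] at hws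
        refine ⟨w, ⟨hw, ?_⟩, fun j hj => ?_⟩
        · simp [hws a (Finset.mem_insert_self _ _), hws i (Finset.mem_insert_of_mem hi)]
        · rw [hws j (Finset.mem_insert_of_mem hj), hf j (hne hj)]
      · intro c hc t w hw hwt
        refine hgen (fun j => c (if j = a then i else j)) ?_ t w hw.1 ?_
        · intro q _
          obtain ⟨j, hj, hjq⟩ := hc (Set.mem_univ q)
          exact ⟨j, Finset.mem_insert_of_mem hj, by simp [hne hj, hjq]⟩
        · intro j hj
          rcases Finset.mem_insert.1 hj with rfl | hj
          · have : w j - w i = 0 := LinearMap.mem_ker.1 hw.2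
            rw [if_pos rfl, ← hwt i hi]
            linarith
          · rw [hf j (hne hj), hwt j hj]
    have hsum := Finset.sum_congr rfl hres
    rw [Finset.sum_add_distrib, Finset.sum_const, Finset.sum_const, hS, smul_eq_mul,
      smul_eq_mul] at hsum
    rw [hS] at hdel
    rw [ncard_regions_offDiag_insert W ha hW, hm, stirlingSum_succ_succ,
      Nat.factorial_succ (m + 1)]
    linarith

end Braid

/-! ### The counting function of a finite set of indices. -/

section CountingFunction

/-- The number of elements of `I` that are at most `p`. -/
def countLE (I : Finset ℕ) (p : ℕ) : ℕ := (I.filter (· ≤ p)).card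

lemma countLE_mono (I : Finset ℕ) : Monotone (countLE I) := fun _ _ h =>
  Finset.card_le_card (Finset.monotone_filter_right _ fun _ _ h' => h'.trans h)

lemma countLE_zero {I : Finset ℕ} {k : ℕ} (hI : I ⊆ Finset.Icc 1 k) : countLE I 0 = 0 := by
  rw [countLE, Finset.card_eq_zero, Finset.filter_eq_empty_iff]
  intro l hl h
  have := Finset.mem_Icc.1 (hI hl)
  omega

lemma countLE_of_le {I : Finset ℕ} {k p : ℕ} (hI : I ⊆ Finset.Icc 1 k) (hp : k ≤ p) :
    countLE I p = I.card := by
  rw [countLE, Finset.filter_true_of_mem]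
  exact fun l hl => (Finset.mem_Icc.1 (hI hl)).2.trans hp

lemma countLE_succ (I : Finset ℕ) (p : ℕ) :
    countLE I (p + 1) = countLE I p + if p + 1 ∈ I then 1 else 0 := by
  have h : I.filter (· ≤ p + 1) = I.filter (· ≤ p) ∪ I.filter (· = p + 1) := by
    rw [← Finset.filter_or]
    exact Finset.filter_congr fun l _ => by omega
  rw [countLE, h, Finset.card_union_of_disjoint, countLE, Finset.filter_eq']
  · split_ifs <;> simp
  · rw [Finset.disjoint_filter]
    intro l _ h1 h2
    omega

lemma exists_eq_of_succ_le (f : ℕ → ℕ) (h0 : f 0 = 0) (hf : ∀ p, f (p + 1) ≤ f p + 1) (k q : ℕ)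
    (hq : q ≤ f k) : ∃ p ≤ k, f p = q := by
  induction k with
  | zero => exact ⟨0, le_rfl, by omega⟩
  | succ k ih =>
    rcases le_or_gt q (f k) with h | h
    · obtain ⟨p, hp, h'⟩ := ih h
      exact ⟨p, by omega, h'⟩
    · have := hf k
      exact ⟨k + 1, le_rfl, by omega⟩

lemma exists_countLE_eq {I : Finset ℕ} {k q : ℕ} (hI : I ⊆ Finset.Icc 1 k) (hq : q ≤ I.card) :
    ∃ p ≤ k, countLE I p = q := by
  refine exists_eq_of_succ_le _ (countLE_zero hI) (fun p => ?_) k q ?_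
  · rw [countLE_succ]; split_ifs <;> omega
  · rwa [countLE_of_le hI le_rfl]

/-- Equal counts mean equal initial segments of `I`, hence equal tails. Tail sums of coefficients
therefore take at most `I.card + 1` values. -/
lemma filter_lt_eq_of_countLE_eq {I : Finset ℕ} {p q : ℕ} (h : countLE I p = countLE I q) :
    I.filter (p < ·) = I.filter (q < ·) := by
  wlog hpq : p ≤ q generalizing p q
  · exact (this h.symm (le_of_not_ge hpq)).symm
  have h1 : I.filter (· ≤ p) = I.filter (· ≤ q) :=
    Finset.eq_of_subset_of_card_le
      (Finset.monotone_filter_right _ fun _ _ h' => h'.trans hpq) h.symm.le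
  refine Finset.filter_congr fun l hl => ?_
  have := Finset.ext_iff.1 h1 l
  simp only [Finset.mem_filter, hl, true_and] at this
  omega

end CountingFunction

/-! ### Block sums and convex hulls for a generic family. -/

section Walk

variable {ι E : Type*} [Fintype ι] [AddCommGroup E] [Module ℝ E]

/-- No nonconstant combination of the vectors `x i` with at most `d + 1` different coefficients
vanishes. -/
def IsGeneric (d : ℕ) (x : ι → E) : Prop :=
  ∀ c : ι → Fin (d + 1), Function.Surjective c → ∀ t : Fin (d + 1) → ℝ,
    ∑ i, t (c i) • x i = 0 → ∀ p q, t p = t q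

/-- The partial sums of the vectors `x i` grouped into blocks by `c`. -/
def blockSum {k : ℕ} (c : ι → Fin (k + 1)) (x : ι → E) (l : ℕ) : E :=
  ∑ i with (c i).val < l, x i

lemma sum_Ico_sub_succ (u : ℕ → ℝ) {p k : ℕ} (h : p ≤ k) :
    ∑ j ∈ Finset.Ico p k, (u j - u (j + 1)) = u p - u k := by
  induction k, h using Nat.le_induction with
  | base => simp
  | succ k h ih => rw [Finset.sum_Ico_succ_top h, ih]; ring

/-- Abel summation: `u (c i)` telescopes into the differences at levels above `c i` plus the
boundary value `u k`, whose contribution dies because the family sums to zero. -/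
lemma sum_Icc_sub_smul_blockSum {k : ℕ} (c : ι → Fin (k + 1)) (x : ι → E) (hx : ∑ i, x i = 0)
    (u : ℕ → ℝ) :
    ∑ l ∈ Finset.Icc 1 k, (u (l - 1) - u l) • blockSum c x l = ∑ i, u (c i) • x i := by
  have h1 : ∀ i, u (c i) • x i =
      ∑ l ∈ Finset.Icc 1 k, (if (c i).val < l then (u (l - 1) - u l) • x i else 0) + u k • x i := by
    intro i
    have h2 : (Finset.Icc 1 k).filter ((c i).val < ·) =
        (Finset.Ico (c i).val k).image (· + 1) := by
      ext l
      simp only [Finset.mem_filter, Finset.mem_Icc, Finset.mem_image, Finset.mem_Ico]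
      exact ⟨fun h => ⟨l - 1, by omega, by omega⟩, by rintro ⟨j, h, rfl⟩; omega⟩
    rw [← Finset.sum_filter, ← Finset.sum_smul, ← add_smul, h2,
      Finset.sum_image (by intro a _ b _ h; simpa using h)]
    simp only [Nat.add_sub_cancel]
    rw [sum_Ico_sub_succ u (Nat.lt_succ_iff.1 (c i).2)]
    congr 1
    ring
  rw [Finset.sum_congr rfl fun i _ => h1 i, Finset.sum_add_distrib, ← Finset.smul_sum, hx,
    smul_zero, add_zero, Finset.sum_comm]
  refine Finset.sum_congr rfl fun l _ => ?_
  rw [blockSum, Finset.smul_sum, Finset.sum_filter]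

/-- Any `d` of the grouped partial sums of a generic family are linearly independent. -/
lemma IsGeneric.eq_zero_of_sum_smul_blockSum {d k : ℕ} {x : ι → E} (hx : IsGeneric d x)
    {c : ι → Fin (k + 1)} (hc : Function.Surjective c) {I : Finset ℕ} (hI : I ⊆ Finset.Icc 1 k)
    (hcard : I.card = d) (a : ℕ → ℝ) (h0 : ∑ l ∈ I, a l • blockSum c x l = 0) :
    ∀ l ∈ I, a l = 0 := by
  -- `u (c i)` is the coefficient of `x i` in the given relation. It depends only on `countLE I (c
  -- i)`, so genericity makes `u` constant, and `a l` is the drop `u (l - 1) - u l`.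
  set u : ℕ → ℝ := fun p => ∑ l ∈ I.filter (p < ·), a l with hu
  have hsurj : ∀ q : Fin (d + 1), ∃ i, countLE I (c i) = q := by
    intro q
    obtain ⟨p, hp, hpq⟩ := exists_countLE_eq hI (q := q) (by have := q.2; omega)
    obtain ⟨i, hi⟩ := hc ⟨p, by omega⟩
    exact ⟨i, by rw [hi, hpq]⟩
  have hlt : ∀ p, countLE I p < d + 1 := fun p => by
    rw [← hcard]
    exact Nat.lt_succ_of_le (Finset.card_le_card (Finset.filter_subset _ _))
  choose s hs using hsurj
  have ht : ∀ p, u (c (s ⟨countLE I p, hlt p⟩)) = u p := fun p => by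
    simp only [hu]
    rw [filter_lt_eq_of_countLE_eq (hs ⟨countLE I p, hlt p⟩)]
  have hconst := hx (fun i => ⟨countLE I (c i), hlt _⟩) (fun q => ⟨s q, Fin.ext (hs q)⟩)
    (fun q => u (c (s q))) (by
      simp only [ht]
      rw [← h0]
      simp only [hu, blockSum, Finset.smul_sum, Finset.sum_smul, Finset.sum_filter]
      rw [Finset.sum_comm]
      simp only [ite_smul, zero_smul, smul_ite, smul_zero])
  intro l hl
  have hl1 := Finset.mem_Icc.1 (hI hl)
  have h1 : u (l - 1) = u l := by
    rw [← ht, ← ht l]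
    exact hconst _ _
  have h2 : I.filter (l - 1 < ·) = insert l (I.filter (l < ·)) := by
    ext j
    simp only [Finset.mem_filter, Finset.mem_insert]
    constructor
    · rintro ⟨h3, h4⟩
      by_cases h5 : j = l
      · exact Or.inl h5
      · exact Or.inr ⟨h3, by omega⟩
    · rintro (rfl | ⟨h3, h4⟩)
      · exact ⟨hl, by omega⟩
      · exact ⟨h3, by omega⟩
  simp only [hu] at h1
  rw [h2, Finset.sum_insert (by simp)] at h1
  linarith

lemma IsGeneric.span_blockSum {d k : ℕ} [FiniteDimensional ℝ E] (hd : Module.finrank ℝ E = d)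
    {x : ι → E} (hx : IsGeneric d x) {c : ι → Fin (k + 1)} (hc : Function.Surjective c)
    {I : Finset ℕ} (hI : I ⊆ Finset.Icc 1 k) (hcard : I.card = d) (v : E) :
    ∃ b : ℕ → ℝ, ∑ l ∈ I, b l • blockSum c x l = v := by
  have hli : LinearIndependent ℝ (fun l : I => blockSum c x l) := by
    rw [Fintype.linearIndependent_iff]
    intro g hg l
    have h := hx.eq_zero_of_sum_smul_blockSum hc hI hcard
      (fun l => if h : l ∈ I then g ⟨l, h⟩ else 0) (by
        rw [← Finset.sum_coe_sort, ← hg]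
        exact Finset.sum_congr rfl fun l _ => by simp) l l.2
    simpa using h
  have hspan := hli.span_eq_top_of_card_eq_finrank' (by simp [hcard, hd])
  have hv : v ∈ Submodule.span ℝ (Set.range fun l : I => blockSum c x l) := hspan ▸ trivial
  obtain ⟨b, hb⟩ := (Submodule.mem_span_range_iff_exists_fun ℝ).1 hv
  refine ⟨fun l => if h : l ∈ I then b ⟨l, h⟩ else 0, ?_⟩
  rw [← Finset.sum_coe_sort, ← hb]
  exact Finset.sum_congr rfl fun l _ => by simp

/-- The origin lies in the hull of finitely many points iff it is a convex combination of them. -/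
lemma zero_mem_convexHull_image_iff (S : Finset ℕ) (f : ℕ → E) :
    (0 : E) ∈ convexHull ℝ (f '' (S : Set ℕ)) ↔
      ∃ w : ℕ → ℝ, (∀ i ∈ S, 0 ≤ w i) ∧ ∑ i ∈ S, w i = 1 ∧ ∑ i ∈ S, w i • f i = 0 := by
  classical
  constructor
  · intro h
    rw [mem_convexHull_iff_exists_fintype] at h
    obtain ⟨κ, _, w, z, hw, hw1, hz, hsum⟩ := h
    choose g hg hgz using hz
    refine ⟨fun l => ∑ i with g i = l, w i, fun l _ => Finset.sum_nonneg fun i _ => hw i, ?_, ?_⟩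
    · rw [Finset.sum_fiberwise_of_maps_to (fun i _ => by simpa using hg i), hw1]
    · rw [← hsum, ← Finset.sum_fiberwise_of_maps_to (s := Finset.univ) (t := S) (g := g)
        (fun i _ => by simpa using hg i)]
      refine Finset.sum_congr rfl fun l _ => ?_
      rw [Finset.sum_smul]
      refine Finset.sum_congr rfl fun i hi => ?_
      rw [← hgz i, (Finset.mem_filter.1 hi).2]
  · rintro ⟨w, hw, hw1, h0⟩
    rw [← h0]
    exact (convex_convexHull ℝ _).sum_mem hw hw1 fun i hi =>
      subset_convexHull ℝ _ ⟨i, hi, rfl⟩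

/-- For a generic family, the origin lies in the convex hull of the grouped partial sums iff some
combination of the vectors with strictly decreasing coefficients vanishes. -/
lemma IsGeneric.zero_mem_convexHull_iff {d k : ℕ} [FiniteDimensional ℝ E]
    (hd : Module.finrank ℝ E = d) (hdk : d ≤ k) (hk : 1 ≤ k) {x : ι → E} (hx : IsGeneric d x)
    (hx0 : ∑ i, x i = 0) {c : ι → Fin (k + 1)} (hc : Function.Surjective c) :
    (0 : E) ∈ convexHull ℝ (blockSum c x '' (Finset.Icc 1 k : Set ℕ)) ↔
      ∃ u : Fin (k + 1) → ℝ, StrictAnti u ∧ ∑ i, u (c i) • x i = 0 := by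
  rw [zero_mem_convexHull_image_iff]
  constructor
  · rintro ⟨w, hw, hw1, h0⟩
    have hIcc : (Finset.Icc 1 k).card = k := by simp
    set J := (Finset.Icc 1 k).filter (w · ≠ 0) with hJ
    have hJw : ∀ l ∈ J, 0 < w l := fun l hl => by
      obtain ⟨h1, h2⟩ := Finset.mem_filter.1 hl
      exact lt_of_le_of_ne (hw l h1) (Ne.symm h2)
    -- A support with fewer than `d` indices could be enlarged to `d` independent block sums,
    -- forcing all weights to vanish.
    have hJd : d ≤ J.card := by
      by_contra! hlt
      obtain ⟨I, hJI, hI, hcard⟩ := Finset.exists_subsuperset_card_eq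
        (Finset.filter_subset _ _ : J ⊆ Finset.Icc 1 k) hlt.le (by omega)
      have hout : ∀ l ∈ Finset.Icc 1 k, l ∉ I → w l = 0 := fun l hl hlI => by
        by_contra h
        exact hlI (hJI (Finset.mem_filter.2 ⟨hl, h⟩))
      have h1 := hx.eq_zero_of_sum_smul_blockSum hc hI hcard w (by
        rw [← h0]
        exact Finset.sum_subset hI fun l hl hlI => by rw [hout l hl hlI, zero_smul])
      rw [Finset.sum_eq_zero fun l hl => ?_] at hw1
      · exact zero_ne_one hw1
      · by_cases hlI : l ∈ I
        exacts [h1 l hlI, hout l hl hlI]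
    obtain ⟨I, hIJ, hcard⟩ := Finset.exists_subset_card_eq hJd
    have hI : I ⊆ Finset.Icc 1 k := hIJ.trans (Finset.filter_subset _ _)
    -- Extending `b` by zero off `I`, the coefficients `1 + b l` form a linear relation that is
    -- positive off `I`. A small multiple of it, added to `w`, makes every weight positive, since
    -- `w` is already positive on `I`.
    obtain ⟨b, hb⟩ := hx.span_blockSum hd hc hI hcard (-∑ l ∈ Finset.Icc 1 k, blockSum c x l)
    obtain ⟨ε, hε, hεb⟩ := exists_pos_forall_mul_lt I w (fun l => -(1 + b l))
      fun l hl => hJw l (hIJ hl)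
    set a : ℕ → ℝ := fun l => w l + ε * (1 + if l ∈ I then b l else 0) with ha
    have hapos : ∀ l ∈ Finset.Icc 1 k, 0 < a l := by
      intro l hl
      by_cases hlI : l ∈ I
      · have := hεb l hlI
        simp only [ha, if_pos hlI]
        linarith
      · have := hw l hl
        simp only [ha, if_neg hlI]
        linarith
    have hasum : ∑ l ∈ Finset.Icc 1 k, a l • blockSum c x l = 0 := by
      have h1 : ∑ l ∈ Finset.Icc 1 k, (if l ∈ I then b l else 0) • blockSum c x l =
          ∑ l ∈ I, b l • blockSum c x l := by
        rw [← Finset.sum_subset hI fun l _ hlI => by rw [if_neg hlI, zero_smul]]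
        exact Finset.sum_congr rfl fun l hl => by rw [if_pos hl]
      simp only [ha, add_smul, mul_smul, smul_add, one_smul, Finset.sum_add_distrib, h0,
        ← Finset.smul_sum, h1, hb]
      simp
    -- The coefficients are chosen so that their consecutive drops are the positive weights `a l`.
    refine ⟨fun p => -∑ l ∈ Finset.Icc 1 p.val, a l, ?_, ?_⟩
    · intro p q hpq
      have hpq' : p.val < q.val := hpq
      have hqk := q.2
      refine neg_lt_neg (Finset.sum_lt_sum_of_subset (i := q.val) ?_ ?_ ?_ ?_ ?_)
      · exact Finset.Icc_subset_Icc_right hpq'.le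
      · simp only [Finset.mem_Icc]; omega
      · simp only [Finset.mem_Icc]; omega
      · exact hapos _ (by simp only [Finset.mem_Icc]; omega)
      · intro j hj _
        exact (hapos _ (by simp only [Finset.mem_Icc] at hj ⊢; omega)).le
    · rw [← hasum, ← sum_Icc_sub_smul_blockSum c x hx0 fun p => -∑ l ∈ Finset.Icc 1 p, a l]
      refine Finset.sum_congr rfl fun l hl => ?_
      obtain ⟨l, rfl⟩ : ∃ j, l = j + 1 := ⟨l - 1, by have := Finset.mem_Icc.1 hl; omega⟩
      rw [Finset.sum_Icc_succ_top (by omega), Nat.add_sub_cancel]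
      congr 1
      ring
  · rintro ⟨u, hu, h0⟩
    set v : ℕ → ℝ := fun p => if h : p < k + 1 then u ⟨p, h⟩ else 0 with hv
    have hvc : ∀ p : Fin (k + 1), v p = u p := fun p => dif_pos p.2
    have hpos : ∀ l ∈ Finset.Icc 1 k, 0 < v (l - 1) - v l := by
      intro l hl
      have hl' := Finset.mem_Icc.1 hl
      have h1 := hvc ⟨l - 1, by omega⟩
      have h2 := hvc ⟨l, by omega⟩
      simp only at h1 h2
      rw [h1, h2, sub_pos]
      exact hu (Fin.mk_lt_mk.2 (by omega))
    have hS : 0 < ∑ l ∈ Finset.Icc 1 k, (v (l - 1) - v l) :=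
      Finset.sum_pos hpos ⟨1, by simp [hk]⟩
    refine ⟨fun l => (∑ l ∈ Finset.Icc 1 k, (v (l - 1) - v l))⁻¹ * (v (l - 1) - v l),
      fun l hl => (mul_pos (inv_pos.2 hS) (hpos l hl)).le, ?_, ?_⟩
    · rw [← Finset.mul_sum, inv_mul_cancel₀ hS.ne']
    · simp only [mul_smul]
      rw [← Finset.smul_sum, sum_Icc_sub_smul_blockSum c x hx0]
      simp only [hvc, h0, smul_zero]

end Walk

/-! ### Orderings of the blocks as chambers. -/

section Permutations

variable {ι : Type*} {E : Type} [Fintype ι] [AddCommGroup E] [Module ℝ E] [FiniteDimensional ℝ E]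

lemma perm_eq_of_lt_iff_lt {m : ℕ} {ρ τ : Equiv.Perm (Fin m)}
    (h : ∀ i j, ρ i < ρ j ↔ τ i < τ j) : ρ = τ := by
  have h1 : StrictMono (τ ∘ ρ.symm) := fun i j hij => by
    have := (h (ρ.symm i) (ρ.symm j)).1 (by simpa using hij)
    simpa using this
  have h2 : τ ∘ ρ.symm = id := (StrictMono.range_inj h1 strictMono_id).1
    (by rw [Set.range_id]; exact (τ.surjective.comp ρ.symm.surjective).range_eq)
  ext i
  have := congrFun h2 (ρ i)
  simp at this
  rw [this]

open Classical in
/-- For a generic family, the number of orderings of the blocks for which the origin is outside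
of the convex hull of the partial sums. -/
theorem IsGeneric.card_perm_zero_notMem_convexHull {d k : ℕ} (hd : Module.finrank ℝ E = d)
    (hdk : d ≤ k) (hk : 1 ≤ k) {x : ι → E} (hx : IsGeneric d x) (hx0 : ∑ i, x i = 0)
    {c : ι → Fin (k + 1)} (hc : Function.Surjective c) :
    (Finset.univ.filter fun ρ : Equiv.Perm (Fin (k + 1)) =>
      (0 : E) ∉ convexHull ℝ (blockSum (ρ ∘ c) x '' (Finset.Icc 1 k : Set ℕ))).card =
        2 * stirlingSum (k + 1) d := by
  let φ : (Fin (k + 1) → ℝ) →ₗ[ℝ] E :=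
    { toFun := fun t => ∑ i, t (c i) • x i
      map_add' := fun s t => by simp [add_smul, Finset.sum_add_distrib]
      map_smul' := fun r t => by simp [mul_smul, Finset.smul_sum] }
  -- The kernel of `φ` inherits genericity from `x`: a colouring of the blocks pulls back along `c`
  -- to a colouring of the vectors.
  have hcount := ncard_regions_offDiag_add_stirlingSum (Finset.univ : Finset (Fin (k + 1))) d E φ
    (LinearMap.ker φ) hd (by simp [hdk]) (fun t ht => ⟨t, ht, fun _ _ => rfl⟩) (by
      intro e he t w hw hwt
      have hwt' : w = t ∘ e := funext fun i => hwt i (Finset.mem_univ i)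
      subst hwt'
      refine hx (e ∘ c) (Function.Surjective.comp ?_ hc) t hw
      intro q
      obtain ⟨j, -, hj⟩ := he (Set.mem_univ q)
      exact ⟨j, hj⟩)
  -- A chamber is an ordering of the coordinates. The permutation `ρ` labels the chamber where `t i
  -- > t j` exactly when `ρ i < ρ j`; conversely, sorting `-t` recovers the inverse of `ρ`.
  have hbij : ((Finset.univ.filter fun ρ : Equiv.Perm (Fin (k + 1)) =>
      (0 : E) ∈ convexHull ℝ (blockSum (ρ ∘ c) x '' (Finset.Icc 1 k : Set ℕ))).card) =
      (regions coordDiff (LinearMap.ker φ : Set (Fin (k + 1) → ℝ)) Finset.univ.offDiag).ncard := by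
    rw [← Set.ncard_coe_finset]
    let pat : Equiv.Perm (Fin (k + 1)) → Finset (Fin (k + 1) × Fin (k + 1)) := fun ρ =>
      Finset.univ.filter fun p => ρ p.1 < ρ p.2
    have hinj : Function.Injective pat := fun ρ τ h => perm_eq_of_lt_iff_lt fun i j => by
      have := Finset.ext_iff.1 h (i, j)
      simpa [pat] using this
    rw [← Set.ncard_image_of_injective _ hinj]
    congr 1
    ext s
    simp only [Set.mem_image, Finset.coe_filter, Finset.mem_univ, true_and, Set.mem_ofPred_eq]
    constructor
    · rintro ⟨ρ, hρ, rfl⟩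
      obtain ⟨u, hu, h0⟩ := (hx.zero_mem_convexHull_iff hd hdk hk hx0
        (ρ.surjective.comp hc)).1 hρ
      refine ⟨u ∘ ρ, h0, ?_, ?_⟩
      · rintro ⟨i, j⟩ hij h
        rw [coordDiff_apply, sub_eq_zero] at h
        exact (Finset.mem_offDiag.1 hij).2.2 (ρ.injective (hu.injective h))
      · rintro ⟨i, j⟩
        simp only [pat, Finset.mem_filter, Finset.mem_univ, true_and, Finset.mem_offDiag,
          coordDiff_apply, Function.comp_apply, sub_pos, hu.lt_iff_gt]
        exact ⟨fun h => ⟨fun hij => by simp [hij] at h, h⟩, fun h => h.2⟩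
    · rintro ⟨t, ht, hne, hs⟩
      have htinj : Function.Injective t := fun i j hij => by
        by_contra h
        exact hne (i, j) (by simp [h]) (by simp [hij])
      have hmono := Tuple.monotone_sort (fun i => -t i)
      set σ := Tuple.sort (fun i => -t i)
      have hanti : StrictAnti (t ∘ σ) := by
        refine fun i j hij => lt_of_le_of_ne ?_ fun h => ?_
        · have := hmono hij.le
          simpa using this
        · exact hij.ne' (σ.injective (htinj h))
      refine ⟨σ.symm, (hx.zero_mem_convexHull_iff hd hdk hk hx0
        (σ.symm.surjective.comp hc)).2 ⟨t ∘ σ, hanti, ?_⟩, ?_⟩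
      · simp only [Function.comp_apply, Equiv.apply_symm_apply]
        exact ht
      · ext ⟨i, j⟩
        have h2 : t j < t i ↔ σ.symm i < σ.symm j := by
          have := hanti.lt_iff_gt (a := σ.symm j) (b := σ.symm i)
          simpa using this
        simp only [pat, Finset.mem_filter, Finset.mem_univ, true_and, hs, Finset.mem_offDiag,
          coordDiff_apply, sub_pos, h2]
        exact ⟨fun h => ⟨fun hij => by simp [hij] at h, h⟩, fun h => h.2⟩
  have htotal := Finset.card_filter_add_card_filter_not (s := Finset.univ)
    (fun ρ : Equiv.Perm (Fin (k + 1)) =>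
      (0 : E) ∈ convexHull ℝ (blockSum (ρ ∘ c) x '' (Finset.Icc 1 k : Set ℕ)))
  rw [Finset.card_univ, Fintype.card_perm, Fintype.card_fin, hbij] at htotal
  rw [Finset.card_univ, Fintype.card_fin] at hcount
  omega

end Permutations

/-! ### Index sets as monotone surjections. -/

section Composition

variable {n k : ℕ}

/-- The block map `{0, …, n} → {0, …, k}` with jumps at the elements of `I`. -/
def blockMap (n k : ℕ) (I : Finset ℕ) (j : Fin (n + 1)) : Fin (k + 1) :=
  ⟨min (countLE I j) k, by omega⟩

lemma blockMap_val {I : Finset ℕ} (hI : I ∈ (Finset.Icc 1 n).powersetCard k) (j : Fin (n + 1)) :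
    (blockMap n k I j).val = countLE I j := by
  have h : countLE I j ≤ I.card := Finset.card_le_card (Finset.filter_subset _ _)
  rw [(Finset.mem_powersetCard.1 hI).2] at h
  exact min_eq_left h

lemma countLE_lt_iff {I : Finset ℕ} {i : ℕ} (hi : i ∈ I) (j : ℕ) :
    countLE I j < countLE I i ↔ j < i := by
  constructor
  · intro h
    by_contra! hij
    exact absurd (countLE_mono I hij) (not_le.2 h)
  · intro h
    refine Finset.card_lt_card (Finset.ssubset_iff_of_subset ?_ |>.2 ⟨i, ?_, ?_⟩)
    · exact Finset.monotone_filter_right _ fun _ _ h' => h'.trans h.le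
    · simp [hi]
    · simp [h]

lemma image_countLE {I : Finset ℕ} (hI : I ∈ (Finset.Icc 1 n).powersetCard k) :
    I.image (countLE I) = Finset.Icc 1 k := by
  obtain ⟨hsub, hcard⟩ := Finset.mem_powersetCard.1 hI
  refine Finset.eq_of_subset_of_card_le ?_ ?_
  · intro l hl
    obtain ⟨i, hi, rfl⟩ := Finset.mem_image.1 hl
    rw [Finset.mem_Icc]
    constructor
    · refine Finset.card_pos.2 ⟨i, by simp [hi]⟩
    · rw [← hcard]
      exact Finset.card_le_card (Finset.filter_subset _ _)
  · rw [Finset.card_image_of_injOn, hcard]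
    · simp
    · intro i hi j hj hij
      rcases lt_trichotomy i j with h | h | h
      · exact absurd hij ((countLE_lt_iff hj i).2 h).ne
      · exact h
      · exact absurd hij ((countLE_lt_iff hi j).2 h).ne'

lemma blockSum_blockMap {E : Type*} [AddCommGroup E] {I : Finset ℕ}
    (hI : I ∈ (Finset.Icc 1 n).powersetCard k) (x : Fin (n + 1) → E) {i : ℕ} (hi : i ∈ I) :
    blockSum (blockMap n k I) x (countLE I i) = ∑ j with j.val < i, x j := by
  rw [blockSum]
  congr 1
  refine Finset.filter_congr fun j _ => ?_
  rw [blockMap_val hI, countLE_lt_iff hi]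

lemma image_blockSum_blockMap {E : Type*} [AddCommGroup E] {I : Finset ℕ}
    (hI : I ∈ (Finset.Icc 1 n).powersetCard k) (x : Fin (n + 1) → E) :
    blockSum (blockMap n k I) x '' (Finset.Icc 1 k : Set ℕ) =
      (fun i => ∑ j with j.val < i, x j) '' (I : Set ℕ) := by
  rw [← image_countLE hI, Finset.coe_image, Set.image_image]
  exact Set.image_congr fun i hi => blockSum_blockMap hI x hi

/-- The monotone surjections `{0, …, n} → {0, …, k}`. -/
def monoSurj (n k : ℕ) : Finset (Fin (n + 1) → Fin (k + 1)) :=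
  open Classical in Finset.univ.filter fun b => Monotone b ∧ Function.Surjective b

lemma mem_monoSurj {b : Fin (n + 1) → Fin (k + 1)} :
    b ∈ monoSurj n k ↔ Monotone b ∧ Function.Surjective b := by
  simp [monoSurj]

lemma blockMap_mem_monoSurj {I : Finset ℕ} (hI : I ∈ (Finset.Icc 1 n).powersetCard k) :
    blockMap n k I ∈ monoSurj n k := by
  obtain ⟨hsub, hcard⟩ := Finset.mem_powersetCard.1 hI
  refine mem_monoSurj.2 ⟨fun i j hij => ?_, fun q => ?_⟩
  · rw [Fin.le_def, blockMap_val hI, blockMap_val hI]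
    exact countLE_mono I hij
  · obtain ⟨p, hp, hpq⟩ := exists_countLE_eq hsub (q := q) (by have := q.2; omega)
    exact ⟨⟨p, by omega⟩, Fin.ext (by rw [blockMap_val hI, hpq])⟩

lemma blockMap_injOn :
    Set.InjOn (blockMap n k) ((Finset.Icc 1 n).powersetCard k : Set (Finset ℕ)) := by
  intro I hI J hJ h
  have hcount : ∀ p ≤ n, countLE I p = countLE J p := fun p hp => by
    rw [← blockMap_val hI ⟨p, by omega⟩, ← blockMap_val hJ ⟨p, by omega⟩, h]
  have hIs := (Finset.mem_powersetCard.1 hI).1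
  have hJs := (Finset.mem_powersetCard.1 hJ).1
  have key : ∀ l ∈ Finset.Icc 1 n, (l ∈ I ↔ l ∈ J) := by
    intro l hl
    obtain ⟨h1, h2⟩ := Finset.mem_Icc.1 hl
    obtain ⟨p, rfl⟩ : ∃ p, l = p + 1 := ⟨l - 1, by omega⟩
    have h3 := hcount (p + 1) h2
    rw [countLE_succ, countLE_succ, hcount p (by omega)] at h3
    by_cases hi : p + 1 ∈ I <;> by_cases hj : p + 1 ∈ J <;> simp_all
  ext l
  exact ⟨fun hl => (key l (hIs hl)).1 hl, fun hl => (key l (hJs hl)).2 hl⟩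

/-- A monotone surjection starts at `0`, ends at `k` and climbs by at most one, so it counts its own
jumps; `I` is the set of jump positions. -/
lemma exists_blockMap_eq {b : Fin (n + 1) → Fin (k + 1)} (hb : b ∈ monoSurj n k) :
    ∃ I ∈ (Finset.Icc 1 n).powersetCard k, blockMap n k I = b := by
  obtain ⟨hmono, hsurj⟩ := mem_monoSurj.1 hb
  set β : ℕ → ℕ := fun p => if h : p < n + 1 then (b ⟨p, h⟩).val else 0 with hβ
  have hβb : ∀ p (h : p < n + 1), β p = b ⟨p, h⟩ := fun p h => dif_pos h
  have hβ0 : β 0 = 0 := by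
    obtain ⟨i, hi⟩ := hsurj 0
    have h1 : b ⟨0, by omega⟩ ≤ b i := hmono (Fin.le_def.2 (Nat.zero_le _))
    rw [hi, Fin.le_def] at h1
    rw [hβb 0 (by omega)]
    simpa using h1
  have hβn : β n = k := by
    obtain ⟨i, hi⟩ := hsurj (Fin.last k)
    have h1 : b i ≤ b ⟨n, by omega⟩ := hmono (Fin.le_def.2 (Nat.lt_succ_iff.1 i.2))
    rw [hi, Fin.le_def] at h1
    rw [hβb n (by omega)]
    have h2 := (b ⟨n, by omega⟩).2
    simp only [Fin.val_last] at h1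
    omega
  have hstep : ∀ p, p + 1 < n + 1 → β p ≤ β (p + 1) ∧ β (p + 1) ≤ β p + 1 := by
    intro p hp
    rw [hβb p (by omega), hβb (p + 1) hp]
    refine ⟨hmono (Fin.le_def.2 (Nat.le_succ p)), ?_⟩
    by_contra! hlt
    have h2 := (b ⟨p + 1, hp⟩).2
    obtain ⟨i, hi⟩ := hsurj ⟨(b ⟨p, by omega⟩).val + 1, by omega⟩
    have hi' := congrArg Fin.val hi
    simp only at hi'
    rcases le_or_gt i.val p with h | h
    · have : b i ≤ b ⟨p, by omega⟩ := hmono (Fin.le_def.2 h)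
      rw [Fin.le_def] at this
      omega
    · have : b ⟨p + 1, hp⟩ ≤ b i := hmono (Fin.le_def.2 h)
      rw [Fin.le_def] at this
      omega
  set J := (Finset.Icc 1 n).filter fun l => β (l - 1) ≠ β l with hJ
  have hJs : J ⊆ Finset.Icc 1 n := Finset.filter_subset _ _
  have hcount : ∀ p ≤ n, countLE J p = β p := by
    intro p
    induction p with
    | zero => intro _; rw [countLE_zero hJs, hβ0]
    | succ p ih =>
      intro hp
      rw [countLE_succ, ih (by omega)]
      have h1 := hstep p (by omega)
      have h2 : p + 1 ∈ J ↔ β p ≠ β (p + 1) := by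
        simp only [hJ, Finset.mem_filter, Finset.mem_Icc, Nat.add_sub_cancel]
        exact ⟨fun h => h.2, fun h => ⟨by omega, h⟩⟩
      split_ifs with h3 <;> rw [h2] at h3 <;> omega
  have hmem : J ∈ (Finset.Icc 1 n).powersetCard k :=
    Finset.mem_powersetCard.2 ⟨hJs, by rw [← countLE_of_le hJs le_rfl, hcount n le_rfl, hβn]⟩
  refine ⟨J, hmem, funext fun j => Fin.ext ?_⟩
  rw [blockMap_val hmem, hcount _ (Nat.lt_succ_iff.1 j.2), hβb _ j.2]

lemma sum_powersetCard_blockMap {M : Type*} [AddCommMonoid M]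
    (e : (Fin (n + 1) → Fin (k + 1)) → M) :
    ∑ I ∈ (Finset.Icc 1 n).powersetCard k, e (blockMap n k I) = ∑ b ∈ monoSurj n k, e b :=
  Finset.sum_nbij (blockMap n k) (fun _ hI => blockMap_mem_monoSurj hI) blockMap_injOn
    (fun _ hb => exists_blockMap_eq hb) fun _ _ => rfl

lemma card_monoSurj : (monoSurj n k).card = n.choose k := by
  rw [Finset.card_eq_sum_ones, ← sum_powersetCard_blockMap, ← Finset.card_eq_sum_ones,
    Finset.card_powersetCard, Nat.card_Icc, Nat.add_sub_cancel]

lemma comp_sort_mem_monoSurj {c : Fin (n + 1) → Fin (k + 1)} (hc : Function.Surjective c) :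
    c ∘ Tuple.sort c ∈ monoSurj n k :=
  mem_monoSurj.2 ⟨Tuple.monotone_sort c, hc.comp (Tuple.sort c).surjective⟩

/-- Reordering the blocks permutes the monotone surjections, up to reordering the arguments. -/
lemma sum_monoSurj_perm_comp {M : Type*} [AddCommMonoid M] (e : (Fin (n + 1) → Fin (k + 1)) → M)
    (he : ∀ c (π : Equiv.Perm (Fin (n + 1))), e (c ∘ π) = e c) (ρ : Equiv.Perm (Fin (k + 1))) :
    ∑ b ∈ monoSurj n k, e (ρ ∘ b) = ∑ b ∈ monoSurj n k, e b := by
  set Φ : (Fin (n + 1) → Fin (k + 1)) → (Fin (n + 1) → Fin (k + 1)) :=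
    fun b => (ρ ∘ b) ∘ Tuple.sort (ρ ∘ b)
  have hmaps : Set.MapsTo Φ (monoSurj n k) (monoSurj n k) := fun b hb =>
    comp_sort_mem_monoSurj (ρ.surjective.comp (mem_monoSurj.1 hb).2)
  have hinj : Set.InjOn Φ (monoSurj n k) := by
    intro b hb b' hb' h
    -- Cancelling `ρ` shows that `b` is a rearrangement of `b'`. Both are monotone, and a tuple has
    -- only one monotone rearrangement.
    have h1 : b = b' ∘ ((Tuple.sort (ρ ∘ b)).symm.trans (Tuple.sort (ρ ∘ b'))) := by
      funext j
      have h2 := congrFun h ((Tuple.sort (ρ ∘ b)).symm j)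
      simp only [Φ, Function.comp_apply, Equiv.apply_symm_apply, EmbeddingLike.apply_eq_iff_eq]
        at h2
      simpa using h2
    have h3 := Tuple.unique_monotone (f := b') (σ := Equiv.refl _)
      (τ := (Tuple.sort (ρ ∘ b)).symm.trans (Tuple.sort (ρ ∘ b')))
      (by simpa using (mem_monoSurj.1 hb').1) (by rw [← h1]; exact (mem_monoSurj.1 hb).1)
    rw [h1, ← h3]
    rfl
  exact Finset.sum_nbij Φ hmaps hinj
    (Finset.surjOn_of_injOn_of_card_le Φ hmaps hinj le_rfl) fun b _ => (he _ _).symm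

/-- A family with vanishing sum is generic as soon as any `d` partial sums of each of its
rearrangements are linearly independent. -/
lemma isGeneric_of_linearIndependent {E : Type*} [AddCommGroup E] [Module ℝ E] {d : ℕ}
    {x : Fin (n + 1) → E} (hx0 : ∑ i, x i = 0)
    (h : ∀ σ : Equiv.Perm (Fin (n + 1)), ∀ I ∈ (Finset.Icc 1 n).powersetCard d,
      LinearIndependent ℝ fun i : I => ∑ j with j.val < (i : ℕ), x (σ j)) :
    IsGeneric d x := by
  intro c hc t ht
  -- After sorting, the colour classes are intervals cut at some `I`. Abel summation then gives a
  -- relation between `d` partial sums of the rearranged family, whose coefficients are the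
  -- consecutive differences of `t`.
  set σ := Tuple.sort c
  obtain ⟨I, hI, hIb⟩ := exists_blockMap_eq (comp_sort_mem_monoSurj hc)
  have hxσ : ∑ i, (x ∘ σ) i = 0 := by rw [← hx0]; exact Equiv.sum_comp σ x
  set v : ℕ → ℝ := fun p => if h : p < d + 1 then t ⟨p, h⟩ else 0 with hv
  have hvt : ∀ p : Fin (d + 1), v p = t p := fun p => dif_pos p.2
  have habel := sum_Icc_sub_smul_blockSum (blockMap n d I) (x ∘ σ) hxσ v
  have hinj : Set.InjOn (countLE I) I := by
    refine Finset.card_image_iff.1 ?_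
    rw [image_countLE hI, (Finset.mem_powersetCard.1 hI).2]
    simp
  rw [hIb, ← hIb, ← image_countLE hI, Finset.sum_image hinj,
    Finset.sum_congr rfl fun i hi => by rw [blockSum_blockMap hI _ hi], hIb] at habel
  have hzero : ∑ i, v ((c ∘ σ) i) • (x ∘ σ) i = 0 := by
    rw [← ht, ← Equiv.sum_comp σ fun i => t (c i) • x i]
    exact Finset.sum_congr rfl fun i _ => by rw [hvt]; rfl
  rw [hzero, ← Finset.sum_coe_sort] at habel
  have hli := Fintype.linearIndependent_iff.1 (h σ I hI) _ habel
  have hstep : ∀ l ∈ Finset.Icc 1 d, v (l - 1) = v l := by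
    intro l hl
    rw [← image_countLE hI] at hl
    obtain ⟨i, hi, rfl⟩ := Finset.mem_image.1 hl
    have := hli ⟨i, hi⟩
    simp only at this
    linarith
  have hall : ∀ p ≤ d, v p = v 0 := by
    intro p
    induction p with
    | zero => intro _; rfl
    | succ p ih =>
      intro hp
      rw [← hstep (p + 1) (by simp only [Finset.mem_Icc]; omega), Nat.add_sub_cancel]
      exact ih (by omega)
  intro p q
  rw [← hvt, ← hvt, hall _ (Nat.lt_succ_iff.1 p.2), hall _ (Nat.lt_succ_iff.1 q.2)]

end Composition

/-! ### Measurability of the hull event. -/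

section Measurability

/-- The set is the projection, along the compact simplex of weights, of a closed set of pairs. -/
lemma isClosed_zero_mem_convexHull {X E : Type*} [TopologicalSpace X] [NormedAddCommGroup E]
    [NormedSpace ℝ E] (S : Finset ℕ) {f : X → ℕ → E} (hf : ∀ l, Continuous fun x => f x l) :
    IsClosed {x | (0 : E) ∈ convexHull ℝ (f x '' (S : Set ℕ))} := by
  have : CompactSpace (stdSimplex ℝ S) := isCompact_iff_compactSpace.1 (isCompact_stdSimplex ℝ S)
  have hcl : IsClosed {p : stdSimplex ℝ S × X | ∑ l : S, p.1.1 l • f p.2 l = 0} := by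
    refine isClosed_eq (continuous_finsetSum _ fun l _ => ?_) continuous_const
    exact ((continuous_apply l).comp (continuous_subtype_val.comp continuous_fst)).smul
      ((hf l).comp continuous_snd)
  convert isClosedMap_snd_of_compactSpace _ hcl using 1
  ext x
  simp only [Set.mem_ofPred_eq, zero_mem_convexHull_image_iff, Set.mem_image, Prod.exists,
    exists_eq_right]
  constructor
  · rintro ⟨w, hw, hw1, h0⟩
    refine ⟨⟨fun l => w l, fun l => hw l l.2, ?_⟩, ?_⟩
    · rw [← hw1]; exact Finset.sum_coe_sort S w
    · rw [← h0]; exact Finset.sum_coe_sort S fun l => w l • f x l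
  · rintro ⟨⟨w, hw, hw1⟩, h0⟩
    refine ⟨fun l => if h : l ∈ S then w ⟨l, h⟩ else 0, fun l hl => ?_, ?_, ?_⟩
    · simpa [hl] using hw ⟨l, hl⟩
    · rw [← hw1, ← Finset.sum_coe_sort]
      exact Finset.sum_congr rfl fun l _ => by simp
    · rw [← h0, ← Finset.sum_coe_sort]
      exact Finset.sum_congr rfl fun l _ => by simp

end Measurability

/-! ### Expectations for random bridges. -/

section Bridge

variable {Ω : Type*} [MeasurableSpace Ω] {P : Measure Ω} {d n k : ℕ}

/-- The configurations of vectors whose partial sums, grouped into blocks by `c`, do not contain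
the origin in their convex hull. -/
def avoiding (d k : ℕ) (c : Fin (n + 1) → Fin (k + 1)) :
    Set (Fin (n + 1) → EuclideanSpace ℝ (Fin d)) :=
  {x | 0 ∉ convexHull ℝ (blockSum c x '' (Finset.Icc 1 k : Set ℕ))}

lemma measurableSet_avoiding (c : Fin (n + 1) → Fin (k + 1)) :
    MeasurableSet (avoiding d k c) := by
  refine (isClosed_zero_mem_convexHull (Finset.Icc 1 k) (f := blockSum c) fun l => ?_
    ).measurableSet.compl
  exact continuous_finsetSum _ fun i _ => continuous_apply i

lemma blockSum_comp_perm {E : Type*} [AddCommGroup E] (c : Fin (n + 1) → Fin (k + 1))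
    (π : Equiv.Perm (Fin (n + 1))) (x : Fin (n + 1) → E) :
    blockSum (c ∘ π) x = blockSum c (fun i => x (π.symm i)) := by
  funext l
  rw [blockSum, blockSum, Finset.sum_filter, Finset.sum_filter,
    ← Equiv.sum_comp π fun i => if (c i).val < l then x (π.symm i) else 0]
  simp

lemma IsExchangeable.measureReal_avoiding_comp_perm
    {ξ : Fin (n + 1) → Ω → EuclideanSpace ℝ (Fin d)} (hEx : IsExchangeable P ξ)
    (c : Fin (n + 1) → Fin (k + 1)) (π : Equiv.Perm (Fin (n + 1))) :
    P.real {ω | (fun i => ξ i ω) ∈ avoiding d k (c ∘ π)} =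
      P.real {ω | (fun i => ξ i ω) ∈ avoiding d k c} := by
  have h := (hEx π.symm).measure_mem_eq (measurableSet_avoiding (d := d) c)
  simp only [measureReal_def]
  congr 1
  refine Eq.trans ?_ h
  congr 1
  ext ω
  simp only [avoiding, Set.mem_ofPred_eq, blockSum_comp_perm, Set.mem_preimage]

/-- Exchangeability carries general position over to all rearrangements of the increments. -/
lemma InGeneralPosition.ae_linearIndependent_perm {m : ℕ}
    {ξ : Fin (n + 1) → Ω → EuclideanSpace ℝ (Fin d)} (hGP : InGeneralPosition P ξ m)
    (hEx : IsExchangeable P ξ) :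
    ∀ᵐ ω ∂P, ∀ σ : Equiv.Perm (Fin (n + 1)), ∀ I ∈ (Finset.Icc 1 n).powersetCard m,
      LinearIndependent ℝ fun i : I => ∑ j with j.val < (i : ℕ), ξ (σ j) ω := by
  refine ae_all_iff.2 fun σ => (Filter.eventually_all_finset _).2 fun I hI => ?_
  -- Independence is an open condition, hence measurable, so it passes between families with the
  -- same law.
  have hopen : IsOpen {x : Fin (n + 1) → EuclideanSpace ℝ (Fin d) |
      LinearIndependent ℝ fun i : I => ∑ j with j.val < (i : ℕ), x j} := by
    refine (isOpen_setOfPred_linearIndependent (𝕜 := ℝ) (ι := I)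
      (E := EuclideanSpace ℝ (Fin d))).preimage ?_
    exact continuous_pi fun i => continuous_finsetSum _ fun j _ => continuous_apply j
  exact (hEx σ).symm.ae_mem_snd hopen.measurableSet (ae_iff.2 (hGP I hI))

lemma partialSum_length {Ω : Type*} {ξ : Fin n → Ω → EuclideanSpace ℝ (Fin d)} (ω : Ω) :
    partialSum ξ n ω = ∑ i, ξ i ω := by
  rw [partialSum, Finset.filter_true_of_mem fun i _ => i.2]

lemma InGeneralPosition.ae_isGeneric {ξ : Fin (n + 1) → Ω → EuclideanSpace ℝ (Fin d)}
    (hGP : InGeneralPosition P ξ d) (hBr : IsBridge P ξ) (hEx : IsExchangeable P ξ) :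
    ∀ᵐ ω ∂P, ∑ i, ξ i ω = 0 ∧ IsGeneric d fun i => ξ i ω := by
  filter_upwards [hGP.ae_linearIndependent_perm hEx, hBr] with ω h1 h2
  rw [partialSum_length] at h2
  exact ⟨h2, isGeneric_of_linearIndependent h2 h1⟩

variable [IsProbabilityMeasure P]

open Classical in
lemma integral_halfCount {ξ : Fin (n + 1) → Ω → EuclideanSpace ℝ (Fin d)}
    (hξ : ∀ i, Measurable (ξ i)) (k : ℕ) :
    ∫ ω, halfCount ξ k ω ∂P =
      1 / 2 * ∑ b ∈ monoSurj n k, P.real {ω | (fun i => ξ i ω) ∈ avoiding d k b} := by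
  have hmeas : ∀ b : Fin (n + 1) → Fin (k + 1),
      MeasurableSet {ω | (fun i => ξ i ω) ∈ avoiding d k b} := fun b =>
    measurable_pi_lambda _ hξ (measurableSet_avoiding b)
  rw [← sum_powersetCard_blockMap fun b => P.real {ω | (fun i => ξ i ω) ∈ avoiding d k b}]
  have h : ∀ ω, halfCount ξ k ω = 1 / 2 * ∑ I ∈ (Finset.Icc 1 n).powersetCard k,
      Set.indicator {ω | (fun i => ξ i ω) ∈ avoiding d k (blockMap n k I)} 1 ω := by
    intro ω
    rw [halfCount]
    congr 1
    refine Finset.sum_congr rfl fun I hI => ?_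
    rw [Set.indicator_apply]
    simp only [avoiding, Set.mem_ofPred_eq, image_blockSum_blockMap hI, Pi.one_apply, partialSum]
    congr
  simp only [h]
  rw [integral_const_mul, integral_finsetSum _ fun I _ => ?_]
  · congr 1
    exact Finset.sum_congr rfl fun I _ => integral_indicator_one (hmeas _)
  · exact (integrable_const (1 : ℝ)).indicator (hmeas _)

-- Almost surely the increments are generic, and then the number of `ρ` in the event is a constant.
-- The sum of probabilities is the expectation of that number.
open Classical in
lemma sum_perm_measureReal_avoiding {ξ : Fin (n + 1) → Ω → EuclideanSpace ℝ (Fin d)}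
    (hξ : ∀ i, Measurable (ξ i)) (hBr : IsBridge P ξ) (hEx : IsExchangeable P ξ)
    (hGP : InGeneralPosition P ξ d) (hdk : d ≤ k) (hk : 1 ≤ k) {b : Fin (n + 1) → Fin (k + 1)}
    (hb : Function.Surjective b) :
    ∑ ρ : Equiv.Perm (Fin (k + 1)), P.real {ω | (fun i => ξ i ω) ∈ avoiding d k (ρ ∘ b)} =
      2 * stirlingSum (k + 1) d := by
  have hmeas : ∀ b : Fin (n + 1) → Fin (k + 1),
      MeasurableSet {ω | (fun i => ξ i ω) ∈ avoiding d k b} := fun b =>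
    measurable_pi_lambda _ hξ (measurableSet_avoiding b)
  calc ∑ ρ : Equiv.Perm (Fin (k + 1)), P.real {ω | (fun i => ξ i ω) ∈ avoiding d k (ρ ∘ b)}
      = ∑ ρ : Equiv.Perm (Fin (k + 1)),
          ∫ ω, Set.indicator {ω | (fun i => ξ i ω) ∈ avoiding d k (ρ ∘ b)} 1 ω ∂P :=
        Finset.sum_congr rfl fun ρ _ => (integral_indicator_one (hmeas _)).symm
    _ = ∫ ω, ∑ ρ : Equiv.Perm (Fin (k + 1)),
          Set.indicator {ω | (fun i => ξ i ω) ∈ avoiding d k (ρ ∘ b)} 1 ω ∂P :=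
        (integral_finsetSum _ fun ρ _ => (integrable_const (1 : ℝ)).indicator (hmeas _)).symm
    _ = ∫ ω, (2 * stirlingSum (k + 1) d : ℝ) ∂P := by
        refine integral_congr_ae ?_
        filter_upwards [hGP.ae_isGeneric hBr hEx] with ω hω
        have h := hω.2.card_perm_zero_notMem_convexHull (by simp) hdk hk hω.1 hb
        have h' := congrArg (Nat.cast : ℕ → ℝ) h
        rw [Finset.card_filter] at h'
        rw [Nat.cast_sum, Nat.cast_mul, Nat.cast_ofNat] at h'
        rw [← h']
        refine Finset.sum_congr rfl fun ρ _ => ?_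
        rw [Nat.cast_ite, Nat.cast_one, Nat.cast_zero]
        simp only [Set.indicator_apply, avoiding, Set.mem_ofPred_eq, Pi.one_apply]
    _ = 2 * stirlingSum (k + 1) d := by simp

/-- The sum over cuts is averaged over all block orderings, and the two sums are exchanged: each of
the `n.choose k` cuts then contributes the same constant. -/
theorem integral_halfCount_of_le {ξ : Fin (n + 1) → Ω → EuclideanSpace ℝ (Fin d)}
    (hξ : ∀ i, Measurable (ξ i)) (hBr : IsBridge P ξ) (hEx : IsExchangeable P ξ)
    (hGP : InGeneralPosition P ξ d) (hdk : d ≤ k) (hk : 1 ≤ k) :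
    ∫ ω, halfCount ξ k ω ∂P =
      1 / ((k + 1).factorial : ℝ) * (n.choose k : ℝ) * (stirlingSum (k + 1) d : ℝ) := by
  set e : (Fin (n + 1) → Fin (k + 1)) → ℝ := fun c =>
    P.real {ω | (fun i => ξ i ω) ∈ avoiding d k c} with he
  have h1 : ((k + 1).factorial : ℝ) * ∑ b ∈ monoSurj n k, e b =
      (n.choose k : ℝ) * (2 * stirlingSum (k + 1) d) := by
    calc ((k + 1).factorial : ℝ) * ∑ b ∈ monoSurj n k, e b
        = ∑ ρ : Equiv.Perm (Fin (k + 1)), ∑ b ∈ monoSurj n k, e (ρ ∘ b) := by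
          rw [Finset.sum_congr rfl fun ρ _ => sum_monoSurj_perm_comp e
            (fun c π => hEx.measureReal_avoiding_comp_perm c π) ρ, Finset.sum_const,
            Finset.card_univ, Fintype.card_perm, Fintype.card_fin, nsmul_eq_mul]
      _ = ∑ b ∈ monoSurj n k, (2 * stirlingSum (k + 1) d : ℝ) := by
          rw [Finset.sum_comm]
          exact Finset.sum_congr rfl fun b hb =>
            sum_perm_measureReal_avoiding hξ hBr hEx hGP hdk hk (mem_monoSurj.1 hb).2
      _ = (n.choose k : ℝ) * (2 * stirlingSum (k + 1) d) := by
          rw [Finset.sum_const, card_monoSurj, nsmul_eq_mul]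
  have hfac : ((k + 1).factorial : ℝ) ≠ 0 := by positivity
  rw [integral_halfCount hξ]
  field_simp
  linarith

/-- If the partial sums in question are linearly independent, the origin is never in their
hull. -/
lemma integral_halfCount_of_linearIndependent {ξ : Fin (n + 1) → Ω → EuclideanSpace ℝ (Fin d)}
    {m : ℕ} (hGP : InGeneralPosition P ξ m) (hkm : k ≤ m) (hmn : m ≤ n) :
    ∫ ω, halfCount ξ k ω ∂P = (n.choose k : ℝ) / 2 := by
  have hae : ∀ᵐ ω ∂P, halfCount ξ k ω = (n.choose k : ℝ) / 2 := by
    have hli : ∀ᵐ ω ∂P, ∀ I ∈ (Finset.Icc 1 n).powersetCard m,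
        LinearIndependent ℝ fun i : I => partialSum ξ i ω :=
      (Filter.eventually_all_finset _).2 fun I hI => ae_iff.2 (hGP I hI)
    filter_upwards [hli] with ω hω
    rw [halfCount, Nat.add_sub_cancel, Finset.sum_congr rfl fun I hI => if_pos ?_]
    · simp [Finset.card_powersetCard]
      ring
    · obtain ⟨hIs, hIk⟩ := Finset.mem_powersetCard.1 hI
      -- General position speaks only of `m`-element sets, so `I` is enlarged to one and
      -- independence is inherited.
      obtain ⟨J, hIJ, hJs, hJ⟩ := Finset.exists_subsuperset_card_eq hIs (by omega : I.card ≤ m)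
        (by simpa using hmn)
      have hI' : LinearIndependent ℝ fun i : I => partialSum ξ i ω :=
        (hω J (Finset.mem_powersetCard.2 ⟨hJs, hJ⟩)).comp (fun i : I => (⟨i, hIJ i.2⟩ : J))
          fun i j hij => Subtype.ext (congrArg (fun l : J => (l : ℕ)) hij)
      rw [zero_mem_convexHull_image_iff]
      rintro ⟨w, -, hw1, h0⟩
      have h1 := Fintype.linearIndependent_iff.1 hI' (fun i => w i) (by
        rw [← h0]; exact Finset.sum_coe_sort I fun i => w i • partialSum ξ i ω)
      rw [Finset.sum_eq_zero fun i hi => h1 ⟨i, hi⟩] at hw1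
      exact zero_ne_one hw1
  rw [integral_congr_ae hae]
  simp

end Bridge

/-! ### Cyclic shifts and the uniform law in dimension one. -/

section Uniform

variable {n : ℕ}

/-- Partial sums of the first `r` numbers. -/
def headSum (y : Fin (n + 1) → ℝ) (r : Fin (n + 1)) : ℝ := ∑ j with j < r, y j

/-- Addition in `Fin (n + 1)` wraps around; at the last index the identity survives because the
total is zero. -/
lemma headSum_add_one {y : Fin (n + 1) → ℝ} (hy : ∑ j, y j = 0) (q : Fin (n + 1)) :
    headSum y (q + 1) = headSum y q + y q := by
  have hins : headSum y q + y q = ∑ j with j ≤ q, y j := by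
    have : (Finset.univ.filter fun j => j ≤ q) = insert q (Finset.univ.filter fun j => j < q) := by
      ext j; simp [le_iff_eq_or_lt]
    rw [this, Finset.sum_insert (by simp), headSum, add_comm]
  rw [hins]
  rcases eq_or_ne q (Fin.last n) with rfl | hq
  · rw [Fin.last_add_one, headSum, Finset.filter_true_of_mem fun j _ => Fin.le_last j, hy]
    simp
  · rw [headSum]
    congr 1
    refine Finset.filter_congr fun j _ => ?_
    rw [Fin.lt_def, Fin.val_add_one_of_lt (Fin.lt_last_iff_ne_last.2 hq), Fin.le_def,
      Nat.lt_succ_iff]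

lemma sum_shift_eq {y : Fin (n + 1) → ℝ} (hy : ∑ j, y j = 0) (r : Fin (n + 1)) (i : ℕ)
    (hi : i ≤ n) :
    ∑ j with j.val < i, y (j + r) = headSum y (Fin.ofNat (n + 1) i + r) - headSum y r := by
  induction i with
  | zero => simp
  | succ i ih =>
    have hv : (Fin.ofNat (n + 1) i).val = i := Nat.mod_eq_of_lt (by omega)
    have hs : Fin.ofNat (n + 1) (i + 1) = Fin.ofNat (n + 1) i + 1 := by
      ext; simp [Fin.val_add]
    have : (Finset.univ.filter fun j : Fin (n + 1) => j.val < i + 1) =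
        insert (Fin.ofNat (n + 1) i) (Finset.univ.filter fun j : Fin (n + 1) => j.val < i) := by
      ext j
      simp only [Finset.mem_filter, Finset.mem_univ, true_and, Finset.mem_insert, Fin.ext_iff, hv]
      omega
    rw [this, Finset.sum_insert (by simp only [Finset.mem_filter, Finset.mem_univ,
      true_and, hv, lt_irrefl, not_false_eq_true]), ih (by omega), hs, add_right_comm, headSum_add_one hy]
    ring

/-- The number of positive partial sums of a cyclic shift is the rank of the starting point. -/
lemma card_pos_shift {y : Fin (n + 1) → ℝ} (hy : ∑ j, y j = 0) (r : Fin (n + 1)) :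
    ((Finset.Icc 1 n).filter fun i => 0 < ∑ j with j.val < i, y (j + r)).card =
      (Finset.univ.filter fun q => headSum y r < headSum y q).card := by
  refine Finset.card_nbij (fun i => Fin.ofNat (n + 1) i + r) ?_ ?_ ?_
  · intro i hi
    obtain ⟨h1, h2⟩ := Finset.mem_filter.1 hi
    rw [sum_shift_eq hy r i (Finset.mem_Icc.1 h1).2, sub_pos] at h2
    simpa using h2
  · intro i hi j hj hij
    have h1 := Finset.mem_Icc.1 (Finset.mem_filter.1 hi).1
    have h2 := Finset.mem_Icc.1 (Finset.mem_filter.1 hj).1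
    have h3 := congrArg Fin.val (add_right_cancel hij)
    simpa [Nat.mod_eq_of_lt (show i < n + 1 by omega),
      Nat.mod_eq_of_lt (show j < n + 1 by omega)] using h3
  · intro q hq
    simp only [Finset.coe_filter, Finset.mem_univ, true_and, Set.mem_ofPred_eq] at hq
    have hle : (q - r).val ≤ n := Nat.lt_succ_iff.1 (q - r).2
    have hcast : Fin.ofNat (n + 1) (q - r).val + r = q := by simp
    refine ⟨(q - r).val, ?_, hcast⟩
    simp only [Finset.coe_filter, Finset.mem_Icc, Set.mem_ofPred_eq]
    refine ⟨⟨?_, hle⟩, ?_⟩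
    · rw [Nat.one_le_iff_ne_zero]
      intro h0
      have : q = r := sub_eq_zero.1 (Fin.ext h0)
      rw [this] at hq
      exact lt_irrefl _ hq
    · rw [sum_shift_eq hy r _ hle, hcast, sub_pos]
      exact hq

/-- Distinct values have distinct ranks, and there are as many possible ranks as values. -/
lemma card_rank_eq {S : Fin (n + 1) → ℝ} (hS : Function.Injective S) {m : ℕ} (hm : m ≤ n) :
    (Finset.univ.filter fun r => (Finset.univ.filter fun q => S r < S q).card = m).card = 1 := by
  have hlt : ∀ r, (Finset.univ.filter fun q => S r < S q).card < n + 1 := fun r => by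
    have : (Finset.univ.filter fun q => S r < S q) ⊂ Finset.univ :=
      Finset.filter_ssubset.2 ⟨r, Finset.mem_univ r, lt_irrefl _⟩
    simpa using Finset.card_lt_card this
  have hanti : ∀ r r', S r < S r' → (Finset.univ.filter fun q => S r' < S q).card <
      (Finset.univ.filter fun q => S r < S q).card := fun r r' h => by
    refine Finset.card_lt_card ((Finset.ssubset_iff_of_subset ?_).2 ⟨r', by simp [h], by simp⟩)
    exact Finset.monotone_filter_right _ fun _ _ h' => h.trans h'
  let R : Fin (n + 1) → Fin (n + 1) := fun r => ⟨_, hlt r⟩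
  have hinj : Function.Injective R := fun r r' h => by
    have h' := congrArg Fin.val h
    simp only [R] at h'
    rcases lt_trichotomy (S r) (S r') with h1 | h1 | h1
    · exact absurd h' (hanti _ _ h1).ne'
    · exact hS h1
    · exact absurd h' (hanti _ _ h1).ne
  obtain ⟨r, hr⟩ := Finite.surjective_of_injective hinj ⟨m, by omega⟩
  rw [Finset.card_eq_one]
  refine ⟨r, ?_⟩
  ext r'
  simp only [Finset.mem_filter, Finset.mem_univ, true_and, Finset.mem_singleton]
  constructor
  · intro h
    exact hinj ((Fin.ext h : R r' = ⟨m, by omega⟩).trans hr.symm)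
  · rintro rfl
    exact congrArg Fin.val hr

/-- Two equal heights would make the increments between them sum to zero, a vanishing combination
with coefficients `0` and `1`. Both values occur, since the interval omits the last index. -/
lemma IsGeneric.headSum_injective {y : Fin (n + 1) → ℝ} (hy : IsGeneric 1 y) :
    Function.Injective (headSum y) := by
  have key : ∀ p q : Fin (n + 1), p < q → headSum y p ≠ headSum y q := by
    intro p q hpq h
    have h1 := hy (fun j => if p ≤ j ∧ j < q then 1 else 0) ?_ (fun r => if r = 0 then 0 else 1) ?_
      0 1
    · simp at h1
    · intro r
      refine Fin.cases ?_ (fun r => ?_) r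
      · exact ⟨Fin.last n, by simp [Fin.le_last q]⟩
      · exact ⟨p, by simp [hpq, Subsingleton.elim r 0]⟩
    · have h2 : (Finset.univ.filter fun j => j < q) =
          (Finset.univ.filter fun j => j < p) ∪ Finset.univ.filter fun j => p ≤ j ∧ j < q := by
        ext j
        simp only [Finset.mem_filter, Finset.mem_univ, true_and, Finset.mem_union]
        constructor
        · intro h3
          rcases lt_or_ge j p with h4 | h4
          exacts [Or.inl h4, Or.inr ⟨h4, h3⟩]
        · rintro (h3 | h3)
          exacts [h3.trans hpq, h3.2]
      have h3 : Disjoint (Finset.univ.filter fun j => j < p)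
          (Finset.univ.filter fun j => p ≤ j ∧ j < q) :=
        Finset.disjoint_filter.2 fun j _ h4 h5 => absurd h4 (not_lt.2 h5.1)
      rw [headSum, headSum, h2, Finset.sum_union h3] at h
      have h4 : ∑ j with p ≤ j ∧ j < q, y j = 0 := by linarith
      rw [Finset.sum_filter] at h4
      refine Eq.trans ?_ h4
      refine Finset.sum_congr rfl fun j _ => ?_
      by_cases h5 : p ≤ j ∧ j < q <;> simp [h5]
  intro p q h
  rcases lt_trichotomy p q with h1 | h1 | h1
  exacts [absurd h (key p q h1), h1, absurd h.symm (key q p h1)]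

lemma IsGeneric.coord {d : ℕ} {x : Fin (n + 1) → EuclideanSpace ℝ (Fin 1)} (hx : IsGeneric d x)
    (c : Fin 1) : IsGeneric d fun i => x i c := by
  intro b hb t ht
  refine hx b hb t ?_
  ext c'
  rw [Subsingleton.elim c' c, ← PiLp.proj_apply (𝕜 := ℝ) 2 (fun _ : Fin 1 => ℝ), map_sum]
  simpa using ht

open Classical in
/-- The number of positive partial sums of a sequence of vectors in the coordinate `c`. -/
noncomputable def posCount {d : ℕ} (c : Fin d) (x : Fin (n + 1) → EuclideanSpace ℝ (Fin d)) : ℕ :=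
  ((Finset.Icc 1 n).filter fun i => 0 < (∑ j with j.val < i, x j) c).card

lemma measurable_posCount {d : ℕ} (c : Fin d) : Measurable (posCount (n := n) c) := by
  unfold posCount
  simp only [Finset.card_filter]
  refine Finset.measurable_sum _ fun i _ => Measurable.ite ?_ measurable_const measurable_const
  refine measurableSet_lt measurable_const (Continuous.measurable ?_)
  fun_prop

/-- All `n + 1` cyclic shifts have the same law, and almost surely exactly one of them has `m`
positive partial sums. -/
theorem measureReal_positiveCount_eq {Ω : Type*} [MeasurableSpace Ω] {P : Measure Ω}
    [IsProbabilityMeasure P] {ξ : Fin (n + 1) → Ω → EuclideanSpace ℝ (Fin 1)}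
    (hξ : ∀ i, Measurable (ξ i)) (hBr : IsBridge P ξ) (hEx : IsExchangeable P ξ)
    (hGP : InGeneralPosition P ξ 1) (c : Fin 1) {m : ℕ} (hm : m ≤ n) :
    P.real {ω | positiveCount ξ c ω = m} = 1 / ((n + 1 : ℕ) : ℝ) := by
  have hset : MeasurableSet {x : Fin (n + 1) → EuclideanSpace ℝ (Fin 1) | posCount c x = m} :=
    measurable_posCount c (measurableSet_singleton m)
  have hmeas : ∀ r : Fin (n + 1), MeasurableSet {ω | posCount c (fun i => ξ (i + r) ω) = m} :=
    fun r => measurable_pi_lambda _ (fun i => hξ (i + r)) hset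
  have hshift : ∀ r : Fin (n + 1), P.real {ω | posCount c (fun i => ξ (i + r) ω) = m} =
      P.real {ω | positiveCount ξ c ω = m} := fun r =>
    congrArg ENNReal.toReal ((hEx (Equiv.addRight r)).measure_mem_eq hset)
  have htotal : ∑ r : Fin (n + 1), P.real {ω | posCount c (fun i => ξ (i + r) ω) = m} = 1 := by
    calc ∑ r : Fin (n + 1), P.real {ω | posCount c (fun i => ξ (i + r) ω) = m}
        = ∑ r : Fin (n + 1),
            ∫ ω, Set.indicator {ω | posCount c (fun i => ξ (i + r) ω) = m} 1 ω ∂P :=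
          Finset.sum_congr rfl fun r _ => (integral_indicator_one (hmeas r)).symm
      _ = ∫ ω, ∑ r : Fin (n + 1),
            Set.indicator {ω | posCount c (fun i => ξ (i + r) ω) = m} 1 ω ∂P :=
          (integral_finsetSum _ fun r _ => (integrable_const (1 : ℝ)).indicator (hmeas r)).symm
      _ = ∫ ω, (1 : ℝ) ∂P := by
          refine integral_congr_ae ?_
          filter_upwards [hGP.ae_isGeneric hBr hEx] with ω hω
          have hsum : ∀ (s : Finset (Fin (n + 1))) (f : Fin (n + 1) → Fin (n + 1)),
              (∑ j ∈ s, ξ (f j) ω) c = ∑ j ∈ s, ξ (f j) ω c := fun s f => by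
            simp
          have hy : ∑ j, ξ j ω c = 0 := by
            have h0 := hsum Finset.univ id
            simp only [id, hω.1] at h0
            exact h0.symm
          have h := card_rank_eq (hω.2.coord c).headSum_injective hm
          rw [Finset.card_filter] at h
          have h' := congrArg (Nat.cast : ℕ → ℝ) h
          push_cast at h'
          rw [← h']
          refine Finset.sum_congr rfl fun r _ => ?_
          simp only [Set.indicator_apply, Set.mem_ofPred_eq, Pi.one_apply, posCount, hsum,
            ← card_pos_shift hy r]
      _ = 1 := by simp
  rw [Finset.sum_congr rfl fun r _ => hshift r, Finset.sum_const, Finset.card_univ,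
    Fintype.card_fin, nsmul_eq_mul] at htotal
  rw [eq_div_iff (by positivity), mul_comm]
  exact htotal

end Uniform

end RandomBridge

theorem theorem1p6 {Ω : Type*} [MeasurableSpace Ω] (P : MeasureTheory.Measure Ω)
    [MeasureTheory.IsProbabilityMeasure P] (d n : ℕ) (hn : d + 2 ≤ n)
    (ξ : Fin n → Ω → EuclideanSpace ℝ (Fin d)) (hξ : ∀ i, Measurable (ξ i))
    (hBr : RandomBridge.IsBridge P ξ) (hEx : RandomBridge.IsExchangeable P ξ)
    (hGP : RandomBridge.InGeneralPosition P ξ d) :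
    (∀ k : ℕ, 1 ≤ k → k ≤ n - 1 →
      (∫ ω, RandomBridge.halfCount ξ k ω ∂P =
        1 / ((k + 1).factorial : ℝ) * ((n - 1).choose k : ℝ) *
          (RandomBridge.stirlingSum (k + 1) d : ℝ)) ∧
      -- `M_{k+1,k}` is formed from any random bridge of length `k + 1` in general position
      (∀ {Ω' : Type*} [MeasurableSpace Ω'] (P' : MeasureTheory.Measure Ω')
        [MeasureTheory.IsProbabilityMeasure P']
        (η : Fin (k + 1) → Ω' → EuclideanSpace ℝ (Fin d)), (∀ i, Measurable (η i)) →
        RandomBridge.IsBridge P' η → RandomBridge.IsExchangeable P' η →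
        RandomBridge.InGeneralPosition P' η (min d k) →
        ∫ ω, RandomBridge.halfCount ξ k ω ∂P =
          ((n - 1).choose k : ℝ) * ∫ ω, RandomBridge.halfCount η k ω ∂P')) ∧
    -- in dimension one, the number of positive terms is uniform on `{0, …, n - 1}`
    (d = 1 → ∀ c : Fin d, ∀ m : ℕ, m ≤ n - 1 →
      P.real {ω | RandomBridge.positiveCount ξ c ω = m} = 1 / (n : ℝ)) := by
  obtain ⟨n, rfl⟩ : ∃ l, n = l + 1 := ⟨n - 1, by omega⟩
  simp only [Nat.add_sub_cancel]
  refine ⟨fun k hk hkn => ?_, ?_⟩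
  · rcases le_or_gt d k with hdk | hkd
    · have h := RandomBridge.integral_halfCount_of_le hξ hBr hEx hGP hdk hk
      refine ⟨h, fun P' _ η hη hBr' hEx' hGP' => ?_⟩
      rw [min_eq_left hdk] at hGP'
      rw [h, RandomBridge.integral_halfCount_of_le hη hBr' hEx' hGP' hdk hk, Nat.choose_self]
      push_cast
      ring
    · have h := RandomBridge.integral_halfCount_of_linearIndependent hGP hkd.le (by omega)
      refine ⟨?_, fun P' _ η _ _ _ hGP' => ?_⟩
      -- Here `k < d`, so the Stirling sum is half of `(k + 1)!`, matching the deterministic count.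
      · obtain ⟨j, rfl⟩ : ∃ j, k = j + 1 := ⟨k - 1, by omega⟩
        have hs := congrArg (Nat.cast : ℕ → ℝ)
          (RandomBridge.two_mul_stirlingSum_eq_factorial j d (by omega))
        have hfac : ((j + 1 + 1).factorial : ℝ) ≠ 0 := by positivity
        push_cast at hs
        rw [h]
        field_simp
        rw [mul_assoc, hs]
      · rw [min_eq_right hkd.le] at hGP'
        rw [h, RandomBridge.integral_halfCount_of_linearIndependent hGP' le_rfl le_rfl,
          Nat.choose_self]
        push_cast
        ring
  · rintro rfl c m hm
    exact RandomBridge.measureReal_positiveCount_eq hξ hBr hEx hGP c hm
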